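/- **Theorem (Avoidance of smooth mean curvature flows).** Let $n\ge 1$, $0<T\le a$, and let $\mathbb G_{n-1,n}$ be the Grassmannian of hyperplanes through $0$ in $\mathbb R^n$, each $S\in\mathbb G_{n-1,n}$ being identified with the orthogonal projection onto it; put $S^\perp=\mathrm{Id}-S$ and $\operatorname{div}_S X=\operatorname{tr}(S\,\nabla X)$, where $\nabla$ acts in space only. *Spacetime Brakke flows.* A finite Radon measure $\lambda$ on $\mathbb R^n\times\mathbb G_{n-1,n}\times[0,a]$ is a codimension-$1$ spacetime Brakke flow with mass measure $(\mu(t))_{t\in[0,a]}$ if 1. the $\mu(t)$, $t\in[0,a]$, are Radon measures on $\mathbb R^n$ and there are probability measures $\nu_{(x,t)}$ on $\mathbb G_{n-1,n}$ (both families measurable in their parameters) such that $\lambda=\mu(t)\otimes\nu_{(x,t)}\otimes dt$; let $\|\lambda\|=\mu(t)\otimes dt$ be the projection of $\lambda$ to $\mathbb R^n\times[0,a]$; 2. the first variation $\delta\lambda(X)=\int \operatorname{div}_S X(y,t)\,d\lambda(y,S,t)$, $X\in C^1_c(\mathbb R^n\times[0,a],\mathbb R^n)$, is bounded with respect to $\|X\|_\infty$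 and has no part singular to $\|\lambda\|$, that is, there is $h\in L^1(\|\lambda\|;\mathbb R^n)$ (the spacetime mean curvature) with $\delta\lambda(X)=-\int X\cdot h\,d\|\lambda\|$ for all such $X$; 3. for all $\varphi\in C^1_c(\mathbb R^n\times[0,a],\mathbb R^+)$ and $0\le t_1\le t_2\le a$, $$\begin{aligned}\int\varphi(\cdot,t_2)\,d\mu(t_2)-\int\varphi(\cdot,t_1)\,d\mu(t_1)\le{}&-\int_{t_1}^{t_2}\!\!\int\varphi|h|^2\,d\mu(t)\,dt+\int_{\mathbb R^n\times\mathbb G_{n-1,n}\times[t_1,t_2]}S^\perp(\nabla\varphi(y,t))\cdot h(y,t)\,d\lambda(y,S,t)\\&+\int_{t_1}^{t_2}\!\!\int\partial_t\varphi\,d\mu(t)\,dt .\end{aligned}$$ It starts from the varifold $V_0=\mu(0)\otimes\nu_{(x,0)}$, a Radon measure on $\mathbb R^n\times\mathbb G_{n-1,n}$. *Classical mean curvature flow.* Let $M\subset\mathbb R^n$ be a compact embedded $C^2$ hypersurface without boundary. A family $(M_t)_{t\in[0,T]}$ of subsets of $\mathbb R^n$ is a mean curvature flow of $M$ if $M_0=M$,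 the spacetime track $\{(x,t):t\in[0,T],\,x\in M_t\}$ is compact, $M_t\to M$ in the Hausdorff distance as $t\to0^+$, and near each of its points with $t\in(0,T]$ the track is, for times in $(0,T]$, the zero set of a function $u(x,t)$ that is $C^2$ in $x$ and $C^1$ in $t$ (with $\nabla u,\nabla^2u,\partial_tu$ jointly continuous), with $\nabla u\ne0$, and on which the normal velocity equals the mean curvature vector: with $N=\nabla u/|\nabla u|$, $$-\frac{\partial_tu}{|\nabla u|^2}\,\nabla u=-(\operatorname{div}N)\,N\qquad\text{on }\{u=0\},\ t\in(0,T].$$ *Claim.* Let $V_0$ be an $(n-1)$-varifold in $\mathbb R^n$, let $(\mu(t))_{t\in[0,a]}$ be the mass measure of a codimension-$1$ spacetime Brakke flow starting from $V_0$, and let $(M_t)_{t\in[0,T]}$ be a mean curvature flow of a compact embedded $C^2$ hypersurface $M$. Then $$\operatorname{supp}\mu(0)\cap M_0=\emptyset\quad\Longrightarrow\quad\operatorname{supp}\mu(t)\cap M_t=\emptyset\quad\text{for all }t\in[0,T].$$ -/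

import Mathlib

open MeasureTheory Set Filter Topology ProbabilityTheory

namespace BrakkeFlow

/-- Euclidean space `ℝⁿ`. -/
abbrev E (n : ℕ) := EuclideanSpace ℝ (Fin n)

/-- The Grassmannian of `d`-dimensional linear subspaces of `ℝⁿ`, each subspace being identified
with the orthogonal projection onto it. The topology and the Borel `σ`-algebra are those induced
from the space of linear maps. -/
abbrev Grass (d n : ℕ) :=
  {S : E n →L[ℝ] E n // IsStarProjection S ∧ Module.finrank ℝ (LinearMap.range S.toLinearMap) = d}

/-- `div_S A = tr (S A)`: for `A = DX(y)` this is the tangential divergence of `X` along `S`. -/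
noncomputable def traceAlong {d n : ℕ} (S : Grass d n) (A : E n →L[ℝ] E n) : ℝ :=
  LinearMap.trace ℝ (E n) (S.1 ∘L A).toLinearMap

/-- The spatial gradient of a function on `ℝⁿ × ℝ`. -/
noncomputable def spaceGrad {n : ℕ} (f : E n × ℝ → ℝ) (p : E n × ℝ) : E n :=
  gradient (fun y => f (y, p.2)) p.1

/-- The spatial differential of a function or vector field on `ℝⁿ × ℝ`. -/
noncomputable def spaceDeriv {n : ℕ} {F : Type*} [NormedAddCommGroup F] [NormedSpace ℝ F]
    (f : E n × ℝ → F) (p : E n × ℝ) : E n →L[ℝ] F :=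
  fderiv ℝ (fun y => f (y, p.2)) p.1

/-- The time derivative of a function on `ℝⁿ × ℝ`. -/
noncomputable def timeDeriv {n : ℕ} (f : E n × ℝ → ℝ) (p : E n × ℝ) : ℝ :=
  deriv (fun s => f (p.1, s)) p.2

/-! ### Spacetime first variation and spacetime mean curvature

A finite Radon measure on `ℝⁿ × G_{d,n} × [0,a]` is a finite Borel measure on `ℝⁿ × G_{d,n} × ℝ`
that is concentrated on times in `[0,a]` (see the disintegration in `IsSpacetimeBrakkeFlow`). -/

/-- The projection `‖λ‖` of `λ` to `ℝⁿ × ℝ`. -/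
noncomputable def massMeasure {d n : ℕ} (lam : Measure (E n × Grass d n × ℝ)) :
    Measure (E n × ℝ) :=
  lam.map (fun p => (p.1, p.2.2))

/-- `δλ(X) = ∫ div_S X(y,t) dλ(y,S,t)`. -/
noncomputable def firstVariation {d n : ℕ} (lam : Measure (E n × Grass d n × ℝ))
    (X : E n × ℝ → E n) : ℝ :=
  ∫ p, traceAlong p.2.1 (spaceDeriv X (p.1, p.2.2)) ∂lam

/-- `δλ` is bounded with respect to the supremum norm over `ℝⁿ × [0,a]`. The fields in
`C¹_c(ℝⁿ × [0,a], ℝⁿ)` are the restrictions of `C¹` fields on `ℝⁿ × ℝ` with compact support. -/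
def HasBoundedFirstVariation {d n : ℕ} (a : ℝ) (lam : Measure (E n × Grass d n × ℝ)) : Prop :=
  ∃ C : ℝ, ∀ X : E n × ℝ → E n, ContDiff ℝ 1 X → HasCompactSupport X →
    ∀ K : ℝ, (∀ y : E n, ∀ t ∈ Icc 0 a, ‖X (y, t)‖ ≤ K) → |firstVariation lam X| ≤ C * K

/-- The first variation of `λ` has no part singular to `‖λ‖`, and `h ∈ L¹(‖λ‖)` is its density:
`δλ(X) = - ∫ X · h d‖λ‖`. In other words, `(δλ)ₛ = 0` and `h` is the spacetime mean
curvature `h(·,·,λ)`, which is unique up to `‖λ‖`-null sets. -/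
def IsSpacetimeMeanCurvature {d n : ℕ} (lam : Measure (E n × Grass d n × ℝ))
    (h : E n × ℝ → E n) : Prop :=
  Integrable h (massMeasure lam) ∧
  ∀ X : E n × ℝ → E n, ContDiff ℝ 1 X → HasCompactSupport X →
    firstVariation lam X = - ∫ q, inner ℝ (X q) (h q) ∂(massMeasure lam)

/-! ### Spacetime Brakke flows -/

/-- Test functions `C¹_c(ℝⁿ × [0,a], ℝ⁺)`: restrictions of compactly supported `C¹` functions
on `ℝⁿ × ℝ` that are nonnegative for times in `[0,a]`. -/
structure IsTestFunction {n : ℕ} (a : ℝ) (φ : E n × ℝ → ℝ) : Prop where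
  contDiff : ContDiff ℝ 1 φ
  hasCompactSupport : HasCompactSupport φ
  nonneg : ∀ y : E n, ∀ t ∈ Icc 0 a, 0 ≤ φ (y, t)

/-- The integral Brakke inequality of `μ`, `λ`, `h` for the test function `φ` on `[t₁, t₂]`.
On the right stand the integrals of `-φ|h|² + ∂ₜφ` against `‖λ‖ = μ(t) ⊗ dt` and of
`S^⊥(∇φ) · h` against `λ`, over times in `[t₁, t₂]`. The left side and the last two integrals are
finite, so the inequality forces the integral of the nonnegative function `φ|h|²` to be finite;
this is the first conjunct. -/
def BrakkeInequality {d n : ℕ} (lam : Measure (E n × Grass d n × ℝ)) (μ : ℝ → Measure (E n))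
    (h : E n × ℝ → E n) (φ : E n × ℝ → ℝ) (t₁ t₂ : ℝ) : Prop :=
  IntegrableOn (fun q => φ q * ‖h q‖ ^ 2) {q | q.2 ∈ Icc t₁ t₂} (massMeasure lam) ∧
  (∫ y, φ (y, t₂) ∂(μ t₂)) - (∫ y, φ (y, t₁) ∂(μ t₁)) ≤
    - (∫ q in {q | q.2 ∈ Icc t₁ t₂}, φ q * ‖h q‖ ^ 2 ∂(massMeasure lam))
    + (∫ p in {p : E n × Grass d n × ℝ | p.2.2 ∈ Icc t₁ t₂},
        inner ℝ (spaceGrad φ (p.1, p.2.2) - p.2.1.1 (spaceGrad φ (p.1, p.2.2))) (h (p.1, p.2.2))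
          ∂lam)
    + (∫ q in {q | q.2 ∈ Icc t₁ t₂}, timeDeriv φ q ∂(massMeasure lam))

/-- `λ = μ(t) ⊗ ν_{(x,t)} ⊗ dt` is a `d`-dimensional spacetime Brakke flow in `ℝⁿ` on the time
interval `[0,a]`, with mass measure `(μ(t))_{t ∈ [0,a]}`. -/
structure IsSpacetimeBrakkeFlow {d n : ℕ} (a : ℝ) (lam : Measure (E n × Grass d n × ℝ))
    (μ : ℝ → Measure (E n)) (ν : Kernel (E n × ℝ) (Grass d n)) : Prop where
  finite : IsFiniteMeasure lam
  radon : ∀ t ∈ Icc 0 a, IsLocallyFiniteMeasure (μ t)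
  isMarkov : IsMarkovKernel ν
  aemeasurable : AEMeasurable μ (volume.restrict (Icc 0 a))
  disintegration : ∀ A : Set (E n × Grass d n × ℝ), MeasurableSet A →
    lam A = ∫⁻ t in Icc 0 a, ∫⁻ x, ν (x, t) {S | (x, S, t) ∈ A} ∂(μ t)
  boundedFirstVariation : HasBoundedFirstVariation a lam
  brakke : ∃ h : E n × ℝ → E n, IsSpacetimeMeanCurvature lam h ∧
    ∀ φ : E n × ℝ → ℝ, IsTestFunction a φ → ∀ t₁ t₂ : ℝ, 0 ≤ t₁ → t₁ ≤ t₂ → t₂ ≤ a →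
      BrakkeInequality lam μ h φ t₁ t₂

/-- The flow starts from the varifold `V₀ = μ(0) ⊗ ν_{(x,0)}`. -/
def StartsFrom {d n : ℕ} (μ : ℝ → Measure (E n)) (ν : Kernel (E n × ℝ) (Grass d n))
    (V₀ : Measure (E n × Grass d n)) : Prop :=
  ∀ A : Set (E n × Grass d n), MeasurableSet A →
    V₀ A = ∫⁻ x, ν (x, 0) {S | (x, S) ∈ A} ∂(μ 0)

/-! ### Classical mean curvature flow of hypersurfaces -/

/-- `M` is an embedded `C²` hypersurface of `ℝⁿ` (without boundary in a neighbourhood of each of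
its points): locally a regular level set of a `C²` function. -/
def IsC2Hypersurface {n : ℕ} (M : Set (E n)) : Prop :=
  ∀ x ∈ M, ∃ U : Set (E n), IsOpen U ∧ x ∈ U ∧ ∃ f : E n → ℝ, ContDiffOn ℝ 2 f U ∧
    ∀ y ∈ U, fderiv ℝ f y ≠ 0 ∧ (y ∈ M ↔ f y = 0)

/-- `u` is of class `C^{2,1}` on the open set `W`: it is `C²` in space and `C¹` in time, and its
first and second spatial derivatives and its time derivative are jointly continuous. -/
structure IsC21On {n : ℕ} (u : E n × ℝ → ℝ) (W : Set (E n × ℝ)) : Prop where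
  contDiffAt_space : ∀ p ∈ W, ContDiffAt ℝ 2 (fun y => u (y, p.2)) p.1
  differentiableAt_time : ∀ p ∈ W, DifferentiableAt ℝ (fun s => u (p.1, s)) p.2
  continuousOn_spaceDeriv : ContinuousOn (spaceDeriv u) W
  continuousOn_spaceDeriv_two : ContinuousOn (spaceDeriv (spaceDeriv u)) W
  continuousOn_timeDeriv : ContinuousOn (timeDeriv u) W

/-- The normal velocity vector of the moving level set `{u(·,t) = 0}` at a point:
`- (∂ₜu / |∇u|²) ∇u`. -/
noncomputable def normalVelocity {n : ℕ} (u : E n × ℝ → ℝ) (p : E n × ℝ) : E n :=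
  - (timeDeriv u p / ‖spaceGrad u p‖ ^ 2) • spaceGrad u p

/-- The unit normal `N = ∇u / |∇u|` of the level sets of `u(·,t)`. -/
noncomputable def unitNormal {n : ℕ} (u : E n × ℝ → ℝ) (p : E n × ℝ) : E n :=
  ‖spaceGrad u p‖⁻¹ • spaceGrad u p

/-- The mean curvature vector `- (div N) N` of the level set of `u(·,t)` through a point. -/
noncomputable def meanCurvatureVector {n : ℕ} (u : E n × ℝ → ℝ) (p : E n × ℝ) : E n :=
  - (LinearMap.trace ℝ (E n) (spaceDeriv (unitNormal u) p).toLinearMap) • unitNormal u p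

/-- `(Γ t)_{t ∈ [0,T]}` is the classical mean curvature flow of the compact `C²` hypersurface `M`.
The spacetime track is compact; the hypersurfaces converge to `M` in the Hausdorff distance as
`t → 0⁺`; and near each of its points at positive time the track is the zero set of a `C^{2,1}`
function with nonvanishing spatial gradient, whose zero set has normal velocity equal to its mean
curvature vector. -/
structure IsMeanCurvatureFlow {n : ℕ} (T : ℝ) (M : Set (E n)) (Γ : ℝ → Set (E n)) : Prop where
  isC2Hypersurface : IsC2Hypersurface M
  initial : Γ 0 = M
  isCompact_track : IsCompact {p : E n × ℝ | p.2 ∈ Icc 0 T ∧ p.1 ∈ Γ p.2}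
  attains_initial : Tendsto (fun t => Metric.hausdorffEDist (Γ t) M) (𝓝[>] 0) (𝓝 0)
  classical : ∀ t₀ ∈ Ioc 0 T, ∀ x₀ ∈ Γ t₀, ∃ W : Set (E n × ℝ), IsOpen W ∧ (x₀, t₀) ∈ W ∧
    ∃ u : E n × ℝ → ℝ, IsC21On u W ∧ (∀ p ∈ W, spaceGrad u p ≠ 0) ∧
      ∀ p ∈ W, p.2 ∈ Ioc 0 T → (p.1 ∈ Γ p.2 ↔ u p = 0) ∧
        (u p = 0 → normalVelocity u p = meanCurvatureVector u p)

end BrakkeFlow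

open BrakkeFlow

/-! The proof is a barrier argument in the viscosity style. If the Brakke flow came close to the
classical flow, then at the first time this happens a translate of the classical flow, moving
slightly too fast, would touch it from outside. A smooth strict subsolution cannot touch a Brakke
flow in this way.

Barrier principle. Let `w` be quadratic in space and affine in time, and test Brakke's inequality
with the cube `φ` of its positive part. Write `S^⊥∇φ = ∇φ - S∇φ` and turn `∫ ∇φ · h` into `-∫ tr_S
D²φ` by the first variation formula. The right side becomes `-∫ (φ|h|² + S∇φ · h + tr_S D²φ - ∂ₜφ)`.
Completing a square in `h` bounds this integrand below by a nonnegative multiple of `w (tr_S D²w -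
∂ₜw) + |S∇w|²`. No orthogonality of `h` to `S` is needed. For a strict subsolution with `∇w ≠ 0`
this quantity is nonnegative for all hyperplanes `S` near the touching point
(`exists_barrier_radius`): if `S` is nearly tangent to the level set the first term is nonnegative,
otherwise `|S∇w|²` dominates. Hence `∫ φ dμ(t)` does not increase (`integral_le_of_pointwise`,
`measure_barrier_pos_eq_zero`), and touching is impossible
(`exists_ball_measure_eq_zero_of_barrier`).

Comparison. With `ρ` below the initial distance and `ε = ρ / (2T)`, consider the first time `t₀` at
which the closed spacetime support of the flow meets the tube of radius `ρ - ε t` around `Γ t`. If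
`t₀ > 0`, take a nearest point `y₀` on `Γ t₀`. The second order jet of the classical flow at `y₀`,
translated along the normal, solves the level set equation; the shrinking rate `ε` of the tube makes
it strict, leaving room for the Taylor error (`quadBarrier_translate_le`,
`exists_ball_measure_eq_zero_of_nearest`). This excludes the contact, and `t₀ = 0` is excluded by
the choice of `ρ`. -/

namespace BrakkeFlow

/-! ### Linear algebra of hyperplane projections -/

theorem Grass.exists_unit_normal {n : ℕ} (hn : 1 ≤ n) (S : Grass (n - 1) n) :
    ∃ f : E n, ‖f‖ = 1 ∧ ∀ x, S.1 x = x - (inner ℝ f x : ℝ) • f := by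
  obtain ⟨S, ⟨hid, hsa⟩, hrank⟩ := S
  have hSS : ∀ x, S (S x) = S x := fun x => by
    have := congrArg (fun T : E n →L[ℝ] E n => T x) hid.eq
    simpa using this
  have hadj : ∀ x y, inner ℝ (S x) y = (inner ℝ x (S y) : ℝ) := by
    intro x y
    have h1 : ContinuousLinearMap.adjoint S = S := hsa
    conv_lhs => rw [← h1]
    exact ContinuousLinearMap.adjoint_inner_left S y x
  have hker : Module.finrank ℝ (LinearMap.ker S.toLinearMap) = 1 := by
    have := LinearMap.finrank_range_add_finrank_ker S.toLinearMap
    rw [hrank, finrank_euclideanSpace_fin] at this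
    omega
  obtain ⟨⟨f₀, hf₀⟩, hne, hspan⟩ := finrank_eq_one_iff'.1 hker
  have hf₀' : f₀ ≠ 0 := fun h => hne (by ext1; exact h)
  have hSf : S f₀ = 0 := hf₀
  refine ⟨‖f₀‖⁻¹ • f₀, norm_smul_inv_norm hf₀', fun x => ?_⟩
  have hk : x - S x ∈ LinearMap.ker S.toLinearMap := by
    simp [LinearMap.mem_ker, hSS]
  obtain ⟨c, hc⟩ := hspan ⟨_, hk⟩
  have hc' : c • f₀ = x - S x := congrArg Subtype.val hc
  have h0 : inner ℝ f₀ (S x) = (0 : ℝ) := by rw [← hadj, hSf, inner_zero_left]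
  have h1 : inner ℝ f₀ x = c * ‖f₀‖ ^ 2 := by
    have := congrArg (fun z => (inner ℝ f₀ z : ℝ)) hc'
    simp only [inner_smul_right, inner_sub_right, h0, real_inner_self_eq_norm_sq] at this
    linarith
  have h2 : S x = x - c • f₀ := by rw [hc']; abel
  rw [h2, inner_smul_left, h1, smul_smul]
  congr 2
  have : ‖f₀‖ ≠ 0 := norm_ne_zero_iff.2 hf₀'
  simp
  field_simp

theorem traceAlong_eq {n : ℕ} (S : Grass (n - 1) n) {f : E n}
    (hf : ∀ x, S.1 x = x - (inner ℝ f x : ℝ) • f) (A : E n →L[ℝ] E n) :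
    traceAlong S A = LinearMap.trace ℝ (E n) A.toLinearMap - inner ℝ f (A f) := by
  have : (S.1 ∘L A).toLinearMap = A.toLinearMap -
      ((InnerProductSpace.rankOne ℝ f f) ∘L A).toLinearMap := by
    ext1 x
    simp [hf]
  rw [traceAlong, this, map_sub]
  congr 1
  have h2 : ((InnerProductSpace.rankOne ℝ f f) ∘L A)
      = InnerProductSpace.rankOne ℝ f (ContinuousLinearMap.adjoint A f) := by
    ext1 x
    simp [ContinuousLinearMap.adjoint_inner_left]
  rw [h2, InnerProductSpace.trace_rankOne, ContinuousLinearMap.adjoint_inner_left]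

theorem norm_sq_of_unit_normal {n : ℕ} {S : E n →L[ℝ] E n} {f : E n} (hf1 : ‖f‖ = 1)
    (hf : ∀ x, S x = x - (inner ℝ f x : ℝ) • f) (x : E n) :
    ‖S x‖ ^ 2 = ‖x‖ ^ 2 - (inner ℝ f x) ^ 2 := by
  rw [hf, ← real_inner_self_eq_norm_sq]
  simp only [inner_sub_left, inner_sub_right, inner_smul_left, inner_smul_right,
    real_inner_self_eq_norm_sq, hf1, real_inner_comm f x]
  simp; ring

theorem Grass.norm_apply_le {n : ℕ} (hn : 1 ≤ n) (S : Grass (n - 1) n) (x : E n) :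
    ‖S.1 x‖ ≤ ‖x‖ := by
  obtain ⟨f, hf1, hf⟩ := S.exists_unit_normal hn
  apply (sq_le_sq₀ (norm_nonneg _) (norm_nonneg _)).1
  rw [norm_sq_of_unit_normal hf1 hf]
  exact sub_le_self _ (sq_nonneg _)

/-- With `g = ⟨e, f⟩ ∈ [0, 1]`, the squares of the two sides are `2(1 - g)` and `4(1 - g)(1 + g)`.
The sign condition on `g` excludes `f` near `-e`. -/
theorem norm_sub_le_of_unit_normal {n : ℕ} {S : E n →L[ℝ] E n} {e f : E n} (he1 : ‖e‖ = 1)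
    (hf1 : ‖f‖ = 1) (hf : ∀ x, S x = x - (inner ℝ f x : ℝ) • f) (hef : 0 ≤ (inner ℝ e f : ℝ)) :
    ‖f - e‖ ≤ 2 * ‖S e‖ := by
  have hg1 := real_inner_le_norm e f
  rw [he1, hf1, one_mul] at hg1
  apply (sq_le_sq₀ (norm_nonneg _) (by positivity)).1
  rw [norm_sub_sq_real, mul_pow, norm_sq_of_unit_normal hf1 hf, he1, hf1, real_inner_comm e f]
  nlinarith

theorem abs_inner_sub_inner_le {n : ℕ} {e f : E n} (he1 : ‖e‖ = 1) (hf1 : ‖f‖ = 1)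
    (A : E n →L[ℝ] E n) :
    |(inner ℝ f (A f) - inner ℝ e (A e) : ℝ)| ≤ 2 * ‖A‖ * ‖f - e‖ := by
  have h0 : (inner ℝ f (A f) - inner ℝ e (A e) : ℝ)
      = inner ℝ (f - e) (A f) + inner ℝ e (A (f - e)) := by
    simp only [inner_sub_left, map_sub, inner_sub_right]; ring
  have h1 := abs_real_inner_le_norm (f - e) (A f)
  have h2 := abs_real_inner_le_norm e (A (f - e))
  have h3 := A.le_opNorm f
  have h4 := A.le_opNorm (f - e)
  rw [hf1, mul_one] at h3
  rw [he1, one_mul] at h2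
  rw [h0]
  have h6 := abs_add_le (inner ℝ (f - e) (A f) : ℝ) (inner ℝ e (A (f - e)))
  have h7 : ‖f - e‖ * ‖A f‖ ≤ ‖f - e‖ * ‖A‖ := by gcongr
  linarith

/-- Here `q` and `A` are the gradient and Hessian of a barrier, `b` its time derivative, and `s` its
value. The margin `m` is `tr_S A - b` for `S = q^⊥`. Tilting `S` lowers it by at most `C |S q|`, a
loss that `|S(q + A y)|²` compensates when `s` and `y` are small. -/
theorem exists_barrier_radius {n : ℕ} (hn : 1 ≤ n) (q : E n) (hq : q ≠ 0) (A : E n →L[ℝ] E n)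
    (b : ℝ) (hb : b * ‖q‖ ^ 2 < LinearMap.trace ℝ (E n) A.toLinearMap * ‖q‖ ^ 2 - inner ℝ q (A q)) :
    ∃ d > 0, ∀ S : Grass (n - 1) n, ∀ y : E n, ‖y‖ < d → ∀ s : ℝ, 0 < s → s < d →
      0 ≤ s * (traceAlong S A - b) + ‖S.1 (q + A y)‖ ^ 2 := by
  have hq0 : 0 < ‖q‖ := norm_pos_iff.2 hq
  set e : E n := ‖q‖⁻¹ • q with he
  have he1 : ‖e‖ = 1 := norm_smul_inv_norm hq
  have hqe : q = ‖q‖ • e := by rw [he, smul_smul, mul_inv_cancel₀ hq0.ne', one_smul]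
  set τ := LinearMap.trace ℝ (E n) A.toLinearMap
  set m := τ - inner ℝ e (A e) - b with hm
  have hm0 : 0 < m := by
    have : inner ℝ q (A q) = ‖q‖ ^ 2 * inner ℝ e (A e) := by
      conv_lhs => rw [hqe]
      simp only [map_smul, inner_smul_left, inner_smul_right]
      simp; ring
    rw [this] at hb
    have h2 : 0 < m * ‖q‖ ^ 2 := by rw [hm]; linarith
    exact pos_of_mul_pos_left h2 (by positivity)
  set C := 4 * (‖A‖ + 1) / ‖q‖ with hC
  have hC0 : 0 < C := by positivity
  -- Both bounds matter only when `|S q| > m / C`. The first then gives `|A y| ≤ |S q| / 4`, the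
  -- second `s C ≤ |S q| / 4`.
  refine ⟨min (m / C / (4 * (‖A‖ + 1))) (m / C / (4 * C)), by positivity, ?_⟩
  intro S y hy s hs0 hs
  obtain ⟨f, hf1, hf⟩ : ∃ f : E n, (‖f‖ = 1 ∧ 0 ≤ (inner ℝ e f : ℝ)) ∧
      ∀ x, S.1 x = x - (inner ℝ f x : ℝ) • f := by
    -- The normal is unique only up to sign; choose the one on the side of `e`.
    obtain ⟨f, hf1, hf⟩ := S.exists_unit_normal hn
    rcases le_total 0 (inner ℝ e f : ℝ) with h | h
    · exact ⟨f, ⟨hf1, h⟩, hf⟩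
    · exact ⟨-f, ⟨by simpa using hf1, by simpa using h⟩, fun x => by simp [hf]⟩
  obtain ⟨hf1, hef⟩ := hf1
  have hfe2 : ‖f - e‖ ≤ 2 * ‖S.1 e‖ := norm_sub_le_of_unit_normal he1 hf1 hf hef
  have hSq : ‖S.1 q‖ = ‖q‖ * ‖S.1 e‖ := by
    conv_lhs => rw [hqe, map_smul, norm_smul, norm_norm]
  have hA : |(inner ℝ f (A f) - inner ℝ e (A e) : ℝ)| ≤ C * ‖S.1 q‖ := by
    have h5 : C * ‖S.1 q‖ = 4 * (‖A‖ + 1) * ‖S.1 e‖ := by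
      rw [hC, hSq]; field_simp
    have h6 := abs_inner_sub_inner_le he1 hf1 A
    have h7 : 2 * ‖A‖ * ‖f - e‖ ≤ 2 * ‖A‖ * (2 * ‖S.1 e‖) := by gcongr
    rw [h5]
    linarith [norm_nonneg (S.1 e)]
  have htr : m - C * ‖S.1 q‖ ≤ traceAlong S A - b := by
    rw [traceAlong_eq S hf]
    have := (abs_le.1 hA).2
    rw [hm]; linarith
  have hkey : s * (m - C * ‖S.1 q‖) ≤ s * (traceAlong S A - b) := by gcongr
  -- For nearly tangent `S` the trace term alone is nonnegative. Otherwise `|S q| > m / C`, and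
  -- `|S(q + A y)|² ≥ |S q|² / 4 ≥ s C |S q|`.
  by_cases hcase : C * ‖S.1 q‖ ≤ m
  · have : 0 ≤ s * (m - C * ‖S.1 q‖) := mul_nonneg hs0.le (by linarith)
    linarith [sq_nonneg ‖S.1 (q + A y)‖]
  push Not at hcase
  have hκ : m / C < ‖S.1 q‖ := by rw [div_lt_iff₀ hC0]; linarith
  have hy' : ‖y‖ * (4 * (‖A‖ + 1)) ≤ ‖S.1 q‖ := by
    have := lt_of_lt_of_le hy (min_le_left _ _)
    rw [lt_div_iff₀ (by positivity)] at this
    linarith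
  have hs' : s * (4 * C) ≤ ‖S.1 q‖ := by
    have := lt_of_lt_of_le hs (min_le_right _ _)
    rw [lt_div_iff₀ (by positivity)] at this
    linarith
  have hS1 := S.norm_apply_le hn
  have hlow : ‖S.1 q‖ / 2 ≤ ‖S.1 (q + A y)‖ := by
    rw [map_add]
    have h1 := norm_sub_le (S.1 q + S.1 (A y)) (S.1 (A y))
    rw [add_sub_cancel_right] at h1
    have h2 := hS1 (A y)
    have h3 := A.le_opNorm y
    nlinarith [norm_nonneg y, norm_nonneg A]
  have h9 : (‖S.1 q‖ / 2) ^ 2 ≤ ‖S.1 (q + A y)‖ ^ 2 := by gcongr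
  have h10 : 0 < ‖S.1 q‖ := lt_trans (by positivity) hκ
  have h11 : s * (4 * C) * ‖S.1 q‖ ≤ ‖S.1 q‖ * ‖S.1 q‖ := by gcongr
  nlinarith [mul_pos hs0 hm0]

end BrakkeFlow

namespace BrakkeFlow

/-! ### The cube of the positive part -/

theorem hasDerivAt_max_zero_pow (k : ℕ) (s : ℝ) :
    HasDerivAt (fun s : ℝ => max s 0 ^ (k + 2)) ((k + 2) * max s 0 ^ (k + 1)) s := by
  rcases lt_trichotomy s 0 with h | h | h
  · rw [max_eq_right h.le]
    have : (fun s : ℝ => max s 0 ^ (k + 2)) =ᶠ[𝓝 s] fun _ => 0 := by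
      filter_upwards [eventually_lt_nhds h] with y hy
      rw [max_eq_right hy.le]; simp
    simpa using (hasDerivAt_const s (0 : ℝ)).congr_of_eventuallyEq this
  · subst h
    rw [hasDerivAt_iff_isLittleO_nhds_zero]
    simp only [zero_add, max_self, ne_eq, Nat.add_eq_zero_iff, one_ne_zero, and_false,
      not_false_eq_true, zero_pow, mul_zero, smul_zero, sub_zero, OfNat.ofNat_ne_zero]
    refine Asymptotics.IsBigO.trans_isLittleO (g := fun x : ℝ => x ^ (k + 2)) ?_ ?_
    · refine Asymptotics.IsBigO.of_bound 1 (Eventually.of_forall fun x => ?_)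
      rw [norm_pow, norm_pow, one_mul]
      gcongr
      rcases le_total x 0 with h | h
      · simp [h]
      · simp [h]
    · have := Asymptotics.isLittleO_pow_pow (𝕜 := ℝ) (m := 1) (n := k + 2) (by omega)
      simpa using this
  · rw [max_eq_left h.le]
    have : (fun s : ℝ => max s 0 ^ (k + 2)) =ᶠ[𝓝 s] fun s => s ^ (k + 2) := by
      filter_upwards [eventually_gt_nhds h] with y hy
      rw [max_eq_left hy.le]
    have h2 := hasDerivAt_pow (k + 2) s
    push_cast at h2
    exact h2.congr_of_eventuallyEq this

/-- Among integer powers of the positive part the cube is the first of class `C²`. This is needed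
because the gradient of the test function is inserted into the first variation. -/
theorem contDiff_max_zero_cube : ContDiff ℝ 2 (fun s : ℝ => max s 0 ^ 3) := by
  have h1 : deriv (fun s : ℝ => max s 0 ^ 3) = fun s => 3 * max s 0 ^ 2 := by
    ext s; rw [(hasDerivAt_max_zero_pow 1 s).deriv]; norm_num
  have h2 : deriv (fun s : ℝ => max s 0 ^ 2) = fun s => 2 * max s 0 := by
    ext s; rw [(hasDerivAt_max_zero_pow 0 s).deriv]; norm_num
  have h3 : ContDiff ℝ 1 (fun s : ℝ => max s 0 ^ 2) := by
    rw [contDiff_one_iff_deriv]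
    refine ⟨fun s => (hasDerivAt_max_zero_pow 0 s).differentiableAt, ?_⟩
    rw [h2]; fun_prop
  rw [show (2 : WithTop ℕ∞) = 1 + 1 by norm_num, contDiff_succ_iff_deriv]
  refine ⟨fun s => (hasDerivAt_max_zero_pow 1 s).differentiableAt, by simp, ?_⟩
  rw [h1]
  exact contDiff_const.mul h3

/-! ### Quadratic barriers -/

/-- A function on spacetime that is quadratic in space and affine in time. -/
noncomputable def quadBarrier {n : ℕ} (c : ℝ) (q : E n) (A : E n →L[ℝ] E n) (b : ℝ) (x₀ : E n)
    (t₀ : ℝ) (p : E n × ℝ) : ℝ :=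
  c + inner ℝ q (p.1 - x₀) + 1 / 2 * inner ℝ (A (p.1 - x₀)) (p.1 - x₀) + b * (p.2 - t₀)

section quadBarrier

variable {n : ℕ} {c : ℝ} {q : E n} {A : E n →L[ℝ] E n} {b : ℝ} {x₀ : E n} {t₀ : ℝ}

theorem contDiff_quadBarrier {k : WithTop ℕ∞} : ContDiff ℝ k (quadBarrier c q A b x₀ t₀) := by
  unfold quadBarrier
  have h1 : ContDiff ℝ k (fun p : E n × ℝ => p.1 - x₀) := contDiff_fst.sub contDiff_const
  have h2 : ContDiff ℝ k (fun p : E n × ℝ => A (p.1 - x₀)) := A.contDiff.comp h1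
  exact ((contDiff_const.add (contDiff_const.inner ℝ h1)).add
    (contDiff_const.mul (h2.inner ℝ h1))).add
    (contDiff_const.mul (contDiff_snd.sub contDiff_const))

theorem hasFDerivAt_quadBarrier_space (hA : ∀ x y, inner ℝ (A x) y = (inner ℝ x (A y) : ℝ))
    (x : E n) (t : ℝ) :
    HasFDerivAt (fun y => quadBarrier c q A b x₀ t₀ (y, t)) (innerSL ℝ (q + A (x - x₀))) x := by
  unfold quadBarrier
  have h1 : HasFDerivAt (fun y : E n => y - x₀) (ContinuousLinearMap.id ℝ (E n)) x :=
    (hasFDerivAt_id x).sub_const x₀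
  have h2 : HasFDerivAt (fun y : E n => A (y - x₀)) A x := by
    have h := A.hasFDerivAt.comp x h1
    rwa [ContinuousLinearMap.comp_id] at h
  have h3 := (((hasFDerivAt_const q x).inner ℝ h1).const_add c).add
    ((h2.inner ℝ h1).const_mul (1 / 2))
  refine (h3.add_const (b * (t - t₀))).congr_fderiv ?_
  ext v
  generalize x - x₀ = z
  simp [hA, real_inner_comm v]
  rw [← real_inner_comm v (A z), hA]
  ring

theorem hasDerivAt_quadBarrier_time (x : E n) (t : ℝ) :
    HasDerivAt (fun s => quadBarrier c q A b x₀ t₀ (x, s)) b t := by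
  unfold quadBarrier
  simpa using (((hasDerivAt_id t).sub_const t₀).const_mul b).const_add
    (c + inner ℝ q (x - x₀) + 1 / 2 * inner ℝ (A (x - x₀)) (x - x₀))

/-- The cube of the positive part of a quadratic barrier. -/
noncomputable def cubeBarrier (c : ℝ) (q : E n) (A : E n →L[ℝ] E n) (b : ℝ) (x₀ : E n)
    (t₀ : ℝ) (p : E n × ℝ) : ℝ :=
  max (quadBarrier c q A b x₀ t₀ p) 0 ^ 3

theorem contDiff_cubeBarrier : ContDiff ℝ 2 (cubeBarrier c q A b x₀ t₀) :=
  contDiff_max_zero_cube.comp contDiff_quadBarrier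

theorem spaceGrad_cubeBarrier (hA : ∀ x y, inner ℝ (A x) y = (inner ℝ x (A y) : ℝ))
    (p : E n × ℝ) :
    spaceGrad (cubeBarrier c q A b x₀ t₀) p
      = (3 * max (quadBarrier c q A b x₀ t₀ p) 0 ^ 2) • (q + A (p.1 - x₀)) := by
  apply HasGradientAt.gradient
  rw [hasGradientAt_iff_hasFDerivAt]
  have h := (hasDerivAt_max_zero_pow 1 _).comp_hasFDerivAt p.1
    (hasFDerivAt_quadBarrier_space (c := c) (q := q) (b := b) (x₀ := x₀) (t₀ := t₀) hA p.1 p.2)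
  refine h.congr_fderiv ?_
  ext v
  simp
  ring

theorem timeDeriv_cubeBarrier (p : E n × ℝ) :
    timeDeriv (cubeBarrier c q A b x₀ t₀) p
      = 3 * max (quadBarrier c q A b x₀ t₀ p) 0 ^ 2 * b := by
  have h := (hasDerivAt_max_zero_pow 1 _).comp p.2
    (hasDerivAt_quadBarrier_time (c := c) (q := q) (A := A) (b := b) (x₀ := x₀) (t₀ := t₀) p.1 p.2)
  refine Eq.trans h.deriv ?_
  rw [show ((1 : ℕ) : ℝ) + 2 = 3 by norm_num]

theorem spaceDeriv_spaceGrad_cubeBarrier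
    (hA : ∀ x y, inner ℝ (A x) y = (inner ℝ x (A y) : ℝ)) (p : E n × ℝ) :
    spaceDeriv (spaceGrad (cubeBarrier c q A b x₀ t₀)) p
      = (3 * max (quadBarrier c q A b x₀ t₀ p) 0 ^ 2) • A
        + (6 * max (quadBarrier c q A b x₀ t₀ p) 0) •
          InnerProductSpace.rankOne ℝ (q + A (p.1 - x₀)) (q + A (p.1 - x₀)) := by
  apply HasFDerivAt.fderiv
  have h0 : (fun y => spaceGrad (cubeBarrier c q A b x₀ t₀) (y, p.2)) = fun y =>
      (3 * max (quadBarrier c q A b x₀ t₀ (y, p.2)) 0 ^ 2) • (q + A (y - x₀)) := by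
    ext1 y; rw [spaceGrad_cubeBarrier hA]
  rw [h0]
  have h1 := ((hasDerivAt_max_zero_pow 0 _).comp_hasFDerivAt p.1
    (hasFDerivAt_quadBarrier_space (c := c) (q := q) (b := b) (x₀ := x₀) (t₀ := t₀) hA
      p.1 p.2)).const_mul 3
  have h2 : HasFDerivAt (fun y : E n => q + A (y - x₀)) A p.1 := by
    have h3 : HasFDerivAt (fun y : E n => y - x₀) (ContinuousLinearMap.id ℝ (E n)) p.1 :=
      (hasFDerivAt_id p.1).sub_const x₀
    have h := A.hasFDerivAt.comp p.1 h3
    rw [ContinuousLinearMap.comp_id] at h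
    exact h.const_add q
  refine (h1.smul h2).congr_fderiv ?_
  generalize q + A (p.1 - x₀) = g
  ext1 v
  simp [InnerProductSpace.rankOne_apply, smul_smul]
  congr 1
  ring

end quadBarrier

theorem traceAlong_smul_add_smul_rankOne {n : ℕ} (hn : 1 ≤ n) (S : Grass (n - 1) n)
    (A : E n →L[ℝ] E n) (g : E n) (r s : ℝ) :
    traceAlong S (r • A + s • InnerProductSpace.rankOne ℝ g g)
      = r * traceAlong S A + s * ‖S.1 g‖ ^ 2 := by
  obtain ⟨f, hf1, hf⟩ := S.exists_unit_normal hn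
  rw [traceAlong_eq S hf, traceAlong_eq S hf, norm_sq_of_unit_normal hf1 hf]
  have : (r • A + s • InnerProductSpace.rankOne ℝ g g).toLinearMap
      = r • A.toLinearMap + s • (InnerProductSpace.rankOne ℝ g g).toLinearMap := rfl
  rw [this, map_add, map_smul, map_smul, InnerProductSpace.trace_rankOne]
  simp [inner_add_right, inner_smul_right, InnerProductSpace.rankOne_apply,
    real_inner_comm f g]
  ring

/-- The pointwise inequality behind the barrier principle: the integrand of Brakke's inequality is
bounded by `∇φ · v + tr_S D²φ` for the cube of a barrier. -/
theorem cubeBarrier_pointwise {n : ℕ} {c : ℝ} {q : E n} {A : E n →L[ℝ] E n} {b : ℝ} {x₀ : E n}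
    {t₀ : ℝ} (hn : 1 ≤ n) (hA : ∀ x y, inner ℝ (A x) y = (inner ℝ x (A y) : ℝ)) (p : E n × ℝ)
    (S : Grass (n - 1) n)
    (h : 0 < quadBarrier c q A b x₀ t₀ p → 0 ≤ quadBarrier c q A b x₀ t₀ p * (traceAlong S A - b)
      + ‖S.1 (q + A (p.1 - x₀))‖ ^ 2) (v : E n) :
    0 ≤ cubeBarrier c q A b x₀ t₀ p * ‖v‖ ^ 2
      + inner ℝ (S.1 (spaceGrad (cubeBarrier c q A b x₀ t₀) p)) v
      + traceAlong S (spaceDeriv (spaceGrad (cubeBarrier c q A b x₀ t₀)) p)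
      - timeDeriv (cubeBarrier c q A b x₀ t₀) p := by
  rw [spaceDeriv_spaceGrad_cubeBarrier hA, traceAlong_smul_add_smul_rankOne hn,
    timeDeriv_cubeBarrier, spaceGrad_cubeBarrier hA, cubeBarrier]
  set w := quadBarrier c q A b x₀ t₀ p
  set g := q + A (p.1 - x₀)
  rcases le_or_gt w 0 with hw | hw
  · rw [max_eq_right hw]; simp
  rw [max_eq_left hw.le, map_smul, inner_smul_left]
  have h1 := h hw
  -- For `w > 0` the expression equals `w` times the sum of this square, `3 (w (tr_S A - b) + |S
  -- g|²)`, and `(3/4) |S g|²`. The coefficient `6` of the rank-one part of the Hessian splits as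
  -- `9/4 + 3 + 3/4`.
  have h2 : 0 ≤ ‖w • v + (3 / 2 : ℝ) • S.1 g‖ ^ 2 := sq_nonneg _
  rw [norm_add_sq_real, norm_smul, norm_smul, inner_smul_left, inner_smul_right] at h2
  simp at h2 ⊢
  rw [mul_pow, mul_pow, sq_abs] at h2
  rw [real_inner_comm v (S.1 g)]
  have h3 := mul_nonneg hw.le h2
  have h4 := mul_nonneg hw.le h1
  nlinarith [mul_nonneg hw.le (sq_nonneg ‖S.1 g‖)]

end BrakkeFlow

namespace BrakkeFlow

/-! ### Regularity of test functions and of their spatial gradients -/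

section Regularity

variable {n : ℕ} {φ : E n × ℝ → ℝ}

theorem spaceDeriv_eq_fderiv_comp_inl {F : Type*} [NormedAddCommGroup F] [NormedSpace ℝ F]
    {X : E n × ℝ → F} (hX : Differentiable ℝ X) (p : E n × ℝ) :
    spaceDeriv X p = (fderiv ℝ X p) ∘L (ContinuousLinearMap.inl ℝ (E n) ℝ) := by
  have h : HasFDerivAt (fun y : E n => (y, p.2)) (ContinuousLinearMap.inl ℝ (E n) ℝ) p.1 :=
    hasFDerivAt_prodMk_left p.1 p.2
  exact ((hX p).hasFDerivAt.comp (x := p.1) (f := fun y : E n => (y, p.2)) h).fderiv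

theorem continuous_spaceDeriv {F : Type*} [NormedAddCommGroup F] [NormedSpace ℝ F]
    {X : E n × ℝ → F} (hX : ContDiff ℝ 1 X) : Continuous (spaceDeriv X) := by
  have : spaceDeriv X = fun p => (fderiv ℝ X p) ∘L (ContinuousLinearMap.inl ℝ (E n) ℝ) :=
    funext (spaceDeriv_eq_fderiv_comp_inl (hX.differentiable (by simp)))
  rw [this]
  exact (hX.continuous_fderiv (by simp)).clm_comp continuous_const

theorem hasCompactSupport_spaceDeriv {F : Type*} [NormedAddCommGroup F] [NormedSpace ℝ F]
    {X : E n × ℝ → F} (hX : ContDiff ℝ 1 X) (hc : HasCompactSupport X) :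
    HasCompactSupport (spaceDeriv X) := by
  refine (hc.fderiv (𝕜 := ℝ)).mono fun p hp h => hp ?_
  rw [spaceDeriv_eq_fderiv_comp_inl (hX.differentiable (by simp)), h]
  simp

theorem spaceGrad_eq_toDual_symm_spaceDeriv (φ : E n × ℝ → ℝ) :
    spaceGrad φ = fun p => (InnerProductSpace.toDual ℝ (E n)).symm (spaceDeriv φ p) := rfl

theorem contDiff_spaceGrad (hφ : ContDiff ℝ 2 φ) : ContDiff ℝ 1 (spaceGrad φ) := by
  rw [spaceGrad_eq_toDual_symm_spaceDeriv]
  refine (InnerProductSpace.toDual ℝ (E n)).symm.contDiff.comp ?_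
  have : spaceDeriv φ = fun p => (fderiv ℝ φ p) ∘L (ContinuousLinearMap.inl ℝ (E n) ℝ) :=
    funext (spaceDeriv_eq_fderiv_comp_inl (hφ.differentiable (by simp)))
  rw [this]
  exact (hφ.fderiv_right (by norm_num)).clm_comp contDiff_const

theorem hasCompactSupport_spaceGrad (hφ : ContDiff ℝ 1 φ) (hc : HasCompactSupport φ) :
    HasCompactSupport (spaceGrad φ) := by
  rw [spaceGrad_eq_toDual_symm_spaceDeriv]
  exact (hasCompactSupport_spaceDeriv hφ hc).comp_left (map_zero _)

theorem continuous_timeDeriv (hφ : ContDiff ℝ 1 φ) : Continuous (timeDeriv φ) := by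
  have : timeDeriv φ = fun p => fderiv ℝ φ p (0, 1) := by
    ext p
    have h : HasDerivAt (fun s : ℝ => (p.1, s)) ((0 : E n), (1 : ℝ)) p.2 :=
      (hasDerivAt_const _ _).prodMk (hasDerivAt_id _)
    exact (((hφ.differentiable (by simp)) p).hasFDerivAt.comp_hasDerivAt (x := p.2)
      (f := fun s : ℝ => (p.1, s)) h).deriv
  rw [this]
  exact (hφ.continuous_fderiv (by simp)).clm_apply continuous_const

theorem hasCompactSupport_timeDeriv (hφ : ContDiff ℝ 1 φ) (hc : HasCompactSupport φ) :
    HasCompactSupport (timeDeriv φ) := by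
  refine (hc.fderiv (𝕜 := ℝ)).mono fun p hp h => hp ?_
  have h' : HasDerivAt (fun s : ℝ => (p.1, s)) ((0 : E n), (1 : ℝ)) p.2 :=
    (hasDerivAt_const _ _).prodMk (hasDerivAt_id _)
  have := (((hφ.differentiable (by simp)) p).hasFDerivAt.comp_hasDerivAt (x := p.2)
      (f := fun s : ℝ => (p.1, s)) h').deriv
  refine Eq.trans this ?_
  rw [h]; simp

theorem spaceDeriv_congr {F : Type*} [NormedAddCommGroup F] [NormedSpace ℝ F]
    {X Y : E n × ℝ → F} {p : E n × ℝ} (h : X =ᶠ[𝓝 p] Y) : spaceDeriv X p = spaceDeriv Y p := by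
  have h1 : Tendsto (fun y : E n => (y, p.2)) (𝓝 p.1) (𝓝 p) :=
    Continuous.tendsto' (by fun_prop) _ _ rfl
  exact Filter.EventuallyEq.fderiv_eq (h1.eventually h)

theorem spaceGrad_congr {ψ : E n × ℝ → ℝ} {p : E n × ℝ}
    (h : φ =ᶠ[𝓝 p] ψ) : spaceGrad φ =ᶠ[𝓝 p] spaceGrad ψ := by
  filter_upwards [h.eventually_nhds] with r hr
  simp only [spaceGrad_eq_toDual_symm_spaceDeriv]
  rw [spaceDeriv_congr hr]

theorem timeDeriv_congr {ψ : E n × ℝ → ℝ} {p : E n × ℝ}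
    (h : φ =ᶠ[𝓝 p] ψ) : timeDeriv φ p = timeDeriv ψ p := by
  have h1 : Tendsto (fun s : ℝ => (p.1, s)) (𝓝 p.2) (𝓝 p) :=
    Continuous.tendsto' (by fun_prop) _ _ rfl
  exact Filter.EventuallyEq.deriv_eq (h1.eventually h)

end Regularity

/-! ### Integrability, and the first variation over a time interval -/

section Integrals

variable {d n : ℕ} {lam : Measure (E n × Grass d n × ℝ)}

theorem continuous_traceAlong : Continuous
    (fun r : Grass d n × (E n →L[ℝ] E n) => traceAlong r.1 r.2) := by
  have h1 : Continuous fun r : Grass d n × (E n →L[ℝ] E n) => r.1.1 ∘L r.2 :=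
    (continuous_subtype_val.comp continuous_fst).clm_comp continuous_snd
  let τ : (E n →L[ℝ] E n) →ₗ[ℝ] ℝ :=
    LinearMap.trace ℝ (E n) ∘ₗ (ContinuousLinearMap.coeLM ℝ)
  have h2 : Continuous τ := τ.continuous_of_finiteDimensional
  exact h2.comp h1

theorem measurable_proj : Measurable (fun p : E n × Grass d n × ℝ => (p.1, p.2.2)) := by
  fun_prop

/-- A continuous function of `(y, S, t)` that vanishes for `(y, t)` outside a compact set and
is, at each point, controlled by a compactly supported continuous function is integrable. -/
theorem integrable_of_norm_le_comp [IsFiniteMeasure lam] {f : E n × Grass d n × ℝ → ℝ}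
    (hf : Continuous f) {g : E n × ℝ → ℝ} (hg : Continuous g) (hgc : HasCompactSupport g)
    (h : ∀ p, ‖f p‖ ≤ g (p.1, p.2.2)) : Integrable f lam := by
  obtain ⟨C, hC⟩ := hg.bounded_above_of_compact_support hgc
  refine Integrable.of_bound hf.aestronglyMeasurable C (Eventually.of_forall fun p => ?_)
  exact (h p).trans ((le_abs_self _).trans (hC _))

end Integrals

end BrakkeFlow

namespace BrakkeFlow

section Integrals

variable {d n : ℕ} {lam : Measure (E n × Grass d n × ℝ)}

theorem exists_abs_traceAlong_le (d n : ℕ) :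
    ∃ C, 0 ≤ C ∧ ∀ (S : Grass d n) (A : E n →L[ℝ] E n), |traceAlong S A| ≤ C * ‖A‖ := by
  let τ : (E n →L[ℝ] E n) →ₗ[ℝ] ℝ :=
    LinearMap.trace ℝ (E n) ∘ₗ (ContinuousLinearMap.coeLM ℝ)
  refine ⟨‖LinearMap.toContinuousLinearMap τ‖, ContinuousLinearMap.opNorm_nonneg _, fun S A => ?_⟩
  have h1 : |traceAlong S A| ≤ ‖LinearMap.toContinuousLinearMap τ‖ * ‖S.1 ∘L A‖ :=
    (LinearMap.toContinuousLinearMap τ).le_opNorm (S.1 ∘L A)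
  have h2 : ‖S.1‖ ≤ 1 := IsStarProjection.norm_le S.1 S.2.1
  have h3 : ‖S.1 ∘L A‖ ≤ 1 * ‖A‖ := (S.1.opNorm_comp_le A).trans (by gcongr)
  rw [one_mul] at h3
  exact h1.trans (by gcongr)

/-- The first variation formula tests only `C¹` fields, so restricting it to a time interval
requires smooth time cutoffs. These bumps equal `1` on the whole interval, and their outer radii
decrease to its half-length. -/
theorem exists_smooth_approx_indicator_Icc {t₁ t₂ : ℝ} (h : t₁ < t₂) :
    ∃ η : ℕ → ℝ → ℝ, (∀ k, ContDiff ℝ 1 (η k)) ∧ (∀ k t, |η k t| ≤ 1) ∧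
      ∀ t, Tendsto (fun k => η k t) atTop (𝓝 ((Icc t₁ t₂).indicator 1 t)) := by
  have hr : 0 < (t₂ - t₁) / 2 := by linarith
  let η : ℕ → ContDiffBump ((t₁ + t₂) / 2) := fun k =>
    ⟨(t₂ - t₁) / 2, (t₂ - t₁) / 2 + 1 / ((k : ℝ) + 1), hr, by
      have : 0 < 1 / ((k : ℝ) + 1) := by positivity
      linarith⟩
  have hball : Metric.closedBall ((t₁ + t₂) / 2) ((t₂ - t₁) / 2) = Icc t₁ t₂ := by
    rw [Real.closedBall_eq_Icc]; congr 1 <;> ring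
  refine ⟨fun k => η k, fun k => (η k).contDiff, fun k t => ?_, fun t => ?_⟩
  · rw [abs_of_nonneg (η k).nonneg]; exact (η k).le_one
  by_cases ht : t ∈ Icc t₁ t₂
  · rw [indicator_of_mem ht]
    refine tendsto_const_nhds.congr fun k => ?_
    exact ((η k).one_of_mem_closedBall (by rw [← hball] at ht; exact ht)).symm
  · rw [indicator_of_notMem ht]
    refine tendsto_const_nhds.congr' ?_
    rw [← hball, Metric.mem_closedBall, not_le] at ht
    have h1 : Tendsto (fun k : ℕ => (t₂ - t₁) / 2 + 1 / ((k : ℝ) + 1)) atTop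
        (𝓝 ((t₂ - t₁) / 2 + 0)) := tendsto_one_div_add_atTop_nhds_zero_nat.const_add _
    rw [add_zero] at h1
    filter_upwards [h1.eventually_lt_const ht] with k hk
    exact ((η k).zero_of_le_dist hk.le).symm

theorem tendsto_integral_mul_indicator_Icc {f : E n × Grass d n × ℝ → ℝ} (hf : Integrable f lam)
    {t₁ t₂ : ℝ} {η : ℕ → ℝ → ℝ} (hη : ∀ k, Continuous (η k)) (hη1 : ∀ k t, |η k t| ≤ 1)
    (hηlim : ∀ t, Tendsto (fun k => η k t) atTop (𝓝 ((Icc t₁ t₂).indicator 1 t))) :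
    Tendsto (fun k => ∫ p, η k p.2.2 * f p ∂lam) atTop
      (𝓝 (∫ p in {p : E n × Grass d n × ℝ | p.2.2 ∈ Icc t₁ t₂}, f p ∂lam)) := by
  have hmeas : MeasurableSet {p : E n × Grass d n × ℝ | p.2.2 ∈ Icc t₁ t₂} :=
    measurableSet_Icc.preimage (measurable_snd.comp measurable_snd)
  rw [← integral_indicator hmeas]
  refine tendsto_integral_of_dominated_convergence (fun p => ‖f p‖)
    (fun k => ((hη k).comp (continuous_snd.comp continuous_snd)).aestronglyMeasurable.mul hf.1)
    hf.norm (fun k => Eventually.of_forall fun p => ?_) (Eventually.of_forall fun p => ?_)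
  · rw [norm_mul]
    exact mul_le_of_le_one_left (norm_nonneg _) (hη1 _ _)
  · have := (hηlim p.2.2).mul_const (f p)
    convert this using 2
    by_cases hp : p.2.2 ∈ Icc t₁ t₂
    · rw [indicator_of_mem hp, indicator_of_mem (by exact hp)]; simp
    · rw [indicator_of_notMem hp, indicator_of_notMem (by exact hp)]; simp

-- A cutoff depending on time alone commutes with the spatial derivative, so it creates no error
-- term.
theorem spaceDeriv_time_smul {X : E n × ℝ → E n} (hX : Differentiable ℝ X) (η : ℝ → ℝ)
    (p : E n × ℝ) : spaceDeriv (fun q : E n × ℝ => η q.2 • X q) p = η p.2 • spaceDeriv X p :=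
  fderiv_fun_const_smul
    (hX.comp (differentiable_id.prodMk (differentiable_const p.2))).differentiableAt (η p.2)

theorem traceAlong_smul (S : Grass d n) (r : ℝ) (A : E n →L[ℝ] E n) :
    traceAlong S (r • A) = r * traceAlong S A := by
  have : (S.1 ∘L (r • A)).toLinearMap = r • (S.1 ∘L A).toLinearMap := by
    ext1 x; simp
  rw [traceAlong, this, map_smul, smul_eq_mul, traceAlong]

/-- The first variation formula, localized to a time interval. -/
theorem IsSpacetimeMeanCurvature.setIntegral_traceAlong [IsFiniteMeasure lam]
    {h : E n × ℝ → E n} (hh : IsSpacetimeMeanCurvature lam h) {X : E n × ℝ → E n}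
    (hX : ContDiff ℝ 1 X) (hc : HasCompactSupport X) {t₁ t₂ : ℝ} (ht : t₁ < t₂) :
    ∫ p in {p : E n × Grass d n × ℝ | p.2.2 ∈ Icc t₁ t₂},
        traceAlong p.2.1 (spaceDeriv X (p.1, p.2.2)) ∂lam
      = - ∫ p in {p : E n × Grass d n × ℝ | p.2.2 ∈ Icc t₁ t₂},
        inner ℝ (X (p.1, p.2.2)) (h (p.1, p.2.2)) ∂lam := by
  obtain ⟨η, hη, hη1, hηlim⟩ := exists_smooth_approx_indicator_Icc ht
  obtain ⟨C, hC0, hC⟩ := exists_abs_traceAlong_le d n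
  have hDX := continuous_spaceDeriv hX
  have hcontS : Continuous fun p : E n × Grass d n × ℝ =>
      traceAlong p.2.1 (spaceDeriv X (p.1, p.2.2)) :=
    continuous_traceAlong.comp ((continuous_fst.comp continuous_snd).prodMk
      (hDX.comp (continuous_fst.prodMk (continuous_snd.comp continuous_snd))))
  have hintS : Integrable (fun p : E n × Grass d n × ℝ =>
      traceAlong p.2.1 (spaceDeriv X (p.1, p.2.2))) lam :=
    integrable_of_norm_le_comp hcontS (g := fun q => C * ‖spaceDeriv X q‖)
      (continuous_const.mul hDX.norm)
      ((hasCompactSupport_spaceDeriv hX hc).norm.mul_left) fun p => hC _ _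
  obtain ⟨K, hK⟩ := hX.continuous.bounded_above_of_compact_support hc
  have hhint : Integrable (fun p : E n × Grass d n × ℝ => h (p.1, p.2.2)) lam :=
    hh.1.comp_measurable measurable_proj
  have hXm : AEStronglyMeasurable (fun p : E n × Grass d n × ℝ => X (p.1, p.2.2)) lam :=
    (hX.continuous.comp (continuous_fst.prodMk
      (continuous_snd.comp continuous_snd))).aestronglyMeasurable
  have hintX : Integrable (fun p : E n × Grass d n × ℝ =>
      (inner ℝ (X (p.1, p.2.2)) (h (p.1, p.2.2)) : ℝ)) lam := by
    refine (hhint.norm.const_mul K).mono' (hXm.inner hhint.1) (Eventually.of_forall fun p => ?_)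
    exact (norm_inner_le_norm _ _).trans (by gcongr; exact hK _)
  refine tendsto_nhds_unique (tendsto_integral_mul_indicator_Icc hintS
    (fun k => (hη k).continuous) hη1 hηlim) ?_
  refine (tendsto_integral_mul_indicator_Icc hintX (fun k => (hη k).continuous)
    hη1 hηlim).neg.congr fun k => ?_
  have hYc : ContDiff ℝ 1 (fun q : E n × ℝ => η k q.2 • X q) :=
    ((hη k).comp contDiff_snd).smul hX
  have hYs : HasCompactSupport (fun q : E n × ℝ => η k q.2 • X q) :=
    hc.mono fun q hq h => hq (by simp only [h, smul_zero])
  have h1 := hh.2 _ hYc hYs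
  rw [massMeasure, integral_map measurable_proj.aemeasurable] at h1
  · rw [firstVariation] at h1
    simp only [spaceDeriv_time_smul (hX.differentiable one_ne_zero), traceAlong_smul,
      inner_smul_left, conj_trivial] at h1
    exact h1.symm
  · exact hYc.continuous.aestronglyMeasurable.inner hh.1.1

end Integrals

/-! ### Monotonicity from Brakke's inequality -/

section Flow

variable {d n : ℕ} {a : ℝ} {lam : Measure (E n × Grass d n × ℝ)} {μ : ℝ → Measure (E n)}
  {ν : Kernel (E n × ℝ) (Grass d n)}

/-- A measurable set that misses the supports of the `μ(t)`, `t ∈ [t₁, t₂)`, is null for `λ` over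
the times in `[t₁, t₂]`. -/
theorem IsSpacetimeBrakkeFlow.ae_restrict_notMem (hflow : IsSpacetimeBrakkeFlow a lam μ ν)
    {t₁ t₂ : ℝ} {B : Set (E n × Grass d n × ℝ)} (hB : MeasurableSet B)
    (h : ∀ t ∈ Ico t₁ t₂, ∀ x ∈ (μ t).support, ∀ S, (x, S, t) ∉ B) :
    ∀ᵐ p ∂(lam.restrict {p | p.2.2 ∈ Icc t₁ t₂}), p ∉ B := by
  have hmeas : MeasurableSet {p : E n × Grass d n × ℝ | p.2.2 ∈ Icc t₁ t₂} :=
    measurableSet_Icc.preimage (measurable_snd.comp measurable_snd)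
  rw [ae_restrict_iff' hmeas, ae_iff]
  have hset : {p : E n × Grass d n × ℝ | ¬(p ∈ {p : E n × Grass d n × ℝ | p.2.2 ∈ Icc t₁ t₂} →
      p ∉ B)} = {p : E n × Grass d n × ℝ | p.2.2 ∈ Icc t₁ t₂} ∩ B := by
    ext p; simp [and_assoc]
  rw [hset, hflow.disintegration _ (hmeas.inter hB)]
  -- The final time is null for `dt`, so nothing has to be known about the support of `μ t₂`; at a
  -- first contact only the earlier times are controlled.
  have hne : ∀ᵐ t ∂(volume.restrict (Icc 0 a)), t ≠ t₂ := by
    refine ae_restrict_of_ae ?_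
    simp [ae_iff]
  rw [← lintegral_zero (μ := volume.restrict (Icc 0 a))]
  refine lintegral_congr_ae ?_
  filter_upwards [hne] with t ht
  rw [← lintegral_zero (μ := μ t)]
  refine lintegral_congr_ae ?_
  filter_upwards [Measure.support_mem_ae (μ := μ t)] with x hx
  convert measure_empty (μ := ν (x, t))
  ext S
  simp only [mem_ofPred_eq, mem_inter_iff, mem_empty_iff_false, iff_false, not_and]
  intro hI
  exact h t ⟨hI.1, lt_of_le_of_ne hI.2 ht⟩ x hx S

/-- The barrier principle in integrated form: if the integrand of Brakke's inequality is pointwise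
controlled by `∇φ · v + tr_S D²φ` on the supports of the `μ(t)`, then `∫ φ dμ(t)` does not
increase. -/
theorem IsSpacetimeBrakkeFlow.integral_le_of_pointwise (hflow : IsSpacetimeBrakkeFlow a lam μ ν)
    {t₁ t₂ : ℝ} (h₁ : 0 ≤ t₁) (h₁₂ : t₁ < t₂) (h₂ : t₂ ≤ a) {φ : E n × ℝ → ℝ}
    (hφ : ContDiff ℝ 2 φ) (hc : HasCompactSupport φ) (hφ0 : ∀ q, 0 ≤ φ q)
    (hpt : ∀ t ∈ Ico t₁ t₂, ∀ x ∈ (μ t).support, ∀ (S : Grass d n) (v : E n),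
      0 ≤ φ (x, t) * ‖v‖ ^ 2 + inner ℝ (S.1 (spaceGrad φ (x, t))) v
        + traceAlong S (spaceDeriv (spaceGrad φ) (x, t)) - timeDeriv φ (x, t)) :
    ∫ y, φ (y, t₂) ∂(μ t₂) ≤ ∫ y, φ (y, t₁) ∂(μ t₁) := by
  have := hflow.finite
  obtain ⟨h, hh, hbr⟩ := hflow.brakke
  have hφ1 : ContDiff ℝ 1 φ := hφ.of_le (by norm_num)
  obtain ⟨hint, hineq⟩ := hbr φ ⟨hφ1, hc, fun y t _ => hφ0 _⟩ t₁ t₂ h₁ h₁₂.le h₂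
  set I : Set (E n × Grass d n × ℝ) := {p | p.2.2 ∈ Icc t₁ t₂} with hI
  have hmeas : MeasurableSet {q : E n × ℝ | q.2 ∈ Icc t₁ t₂} :=
    measurableSet_Icc.preimage measurable_snd
  have hX := contDiff_spaceGrad hφ
  have hXc := hasCompactSupport_spaceGrad hφ1 hc
  -- The first variation in the direction `∇φ` trades the unsigned term `∇φ · h` for the trace of
  -- the Hessian.
  have hfv := hh.setIntegral_traceAlong hX hXc h₁₂
  rw [← hI] at hfv
  have hDX := continuous_spaceDeriv hX
  have hπ : Continuous fun p : E n × Grass d n × ℝ => (p.1, p.2.2) := by fun_prop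
  have hSc : Continuous fun p : E n × Grass d n × ℝ => p.2.1.1 :=
    continuous_subtype_val.comp (continuous_fst.comp continuous_snd)
  -- the integrands as functions on `E n × Grass d n × ℝ`
  have hhint : Integrable (fun p : E n × Grass d n × ℝ => h (p.1, p.2.2)) lam :=
    hh.1.comp_measurable measurable_proj
  obtain ⟨C, hC0, hC⟩ := exists_abs_traceAlong_le d n
  obtain ⟨K, hK⟩ := hX.continuous.bounded_above_of_compact_support hXc
  have i1 : IntegrableOn (fun p : E n × Grass d n × ℝ => φ (p.1, p.2.2) * ‖h (p.1, p.2.2)‖ ^ 2)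
      I lam := by
    rw [massMeasure, IntegrableOn, Measure.restrict_map measurable_proj hmeas] at hint
    exact hint.comp_measurable measurable_proj
  have i2 : Integrable (fun p : E n × Grass d n × ℝ =>
      (inner ℝ (spaceGrad φ (p.1, p.2.2)) (h (p.1, p.2.2)) : ℝ)) lam := by
    refine (hhint.norm.const_mul K).mono'
      ((hX.continuous.comp hπ).aestronglyMeasurable.inner hhint.1)
      (Eventually.of_forall fun p => ?_)
    exact (norm_inner_le_norm _ _).trans (by gcongr; exact hK _)
  have i3 : Integrable (fun p : E n × Grass d n × ℝ =>
      (inner ℝ (p.2.1.1 (spaceGrad φ (p.1, p.2.2))) (h (p.1, p.2.2)) : ℝ)) lam := by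
    refine (hhint.norm.const_mul K).mono'
      ((hSc.clm_apply (hX.continuous.comp hπ)).aestronglyMeasurable.inner hhint.1)
      (Eventually.of_forall fun p => ?_)
    refine (norm_inner_le_norm _ _).trans ?_
    gcongr
    have h2 : ‖p.2.1.1‖ ≤ 1 := IsStarProjection.norm_le p.2.1.1 p.2.1.2.1
    refine (p.2.1.1.le_opNorm _).trans ?_
    exact (mul_le_of_le_one_left (norm_nonneg _) h2).trans (hK _)
  have hcontS : Continuous fun p : E n × Grass d n × ℝ =>
      traceAlong p.2.1 (spaceDeriv (spaceGrad φ) (p.1, p.2.2)) :=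
    continuous_traceAlong.comp ((continuous_fst.comp continuous_snd).prodMk (hDX.comp hπ))
  have i4 : Integrable (fun p : E n × Grass d n × ℝ =>
      traceAlong p.2.1 (spaceDeriv (spaceGrad φ) (p.1, p.2.2))) lam :=
    integrable_of_norm_le_comp hcontS (g := fun q => C * ‖spaceDeriv (spaceGrad φ) q‖)
      (continuous_const.mul hDX.norm)
      ((hasCompactSupport_spaceDeriv hX hXc).norm.mul_left) fun p => hC _ _
  have htc := continuous_timeDeriv hφ1
  have i5 : Integrable (fun p : E n × Grass d n × ℝ => timeDeriv φ (p.1, p.2.2)) lam :=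
    integrable_of_norm_le_comp (htc.comp hπ) (g := fun q => ‖timeDeriv φ q‖) htc.norm
      (hasCompactSupport_timeDeriv hφ1 hc).norm fun p => le_rfl
  -- rewrite all integrals over `E n × Grass d n × ℝ`
  have e1 : ∫ q in {q : E n × ℝ | q.2 ∈ Icc t₁ t₂}, φ q * ‖h q‖ ^ 2 ∂(massMeasure lam)
      = ∫ p in I, φ (p.1, p.2.2) * ‖h (p.1, p.2.2)‖ ^ 2 ∂lam := by
    rw [massMeasure, setIntegral_map hmeas _ measurable_proj.aemeasurable]
    · rfl
    · exact hφ.continuous.aestronglyMeasurable.mul (hh.1.1.norm.pow 2)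
  have e2 : ∫ q in {q : E n × ℝ | q.2 ∈ Icc t₁ t₂}, timeDeriv φ q ∂(massMeasure lam)
      = ∫ p in I, timeDeriv φ (p.1, p.2.2) ∂lam := by
    rw [massMeasure, setIntegral_map hmeas _ measurable_proj.aemeasurable]
    · rfl
    · exact htc.aestronglyMeasurable
  have e3 : ∫ p in I, inner ℝ (spaceGrad φ (p.1, p.2.2) - p.2.1.1 (spaceGrad φ (p.1, p.2.2)))
        (h (p.1, p.2.2)) ∂lam
      = (∫ p in I, inner ℝ (spaceGrad φ (p.1, p.2.2)) (h (p.1, p.2.2)) ∂lam)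
        - ∫ p in I, inner ℝ (p.2.1.1 (spaceGrad φ (p.1, p.2.2))) (h (p.1, p.2.2)) ∂lam := by
    simp only [inner_sub_left]
    exact integral_sub i2.integrableOn i3.integrableOn
  rw [e1, e2, e3] at hineq
  -- the pointwise inequality holds almost everywhere
  let F : E n → E n × Grass d n × ℝ → ℝ := fun v p =>
    φ (p.1, p.2.2) * ‖v‖ ^ 2 + inner ℝ (p.2.1.1 (spaceGrad φ (p.1, p.2.2))) v
      + traceAlong p.2.1 (spaceDeriv (spaceGrad φ) (p.1, p.2.2)) - timeDeriv φ (p.1, p.2.2)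
  have hF : ∀ v, Continuous (F v) := fun v =>
    ((((hφ.continuous.comp hπ).mul continuous_const).add
      ((hSc.clm_apply (hX.continuous.comp hπ)).inner continuous_const)).add hcontS).sub
      (htc.comp hπ)
  -- The union over all `v` is uncountable, but it is open. Outside it the inequality holds for
  -- every `v`, in particular for `v = h`, which is only integrable.
  have hB : MeasurableSet (⋃ v, {p | F v p < 0}) :=
    (isOpen_iUnion fun v => isOpen_lt (hF v) continuous_const).measurableSet
  have hae := hflow.ae_restrict_notMem (t₁ := t₁) (t₂ := t₂) hB (by
    intro t ht x hx S hmem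
    obtain ⟨v, hv⟩ := mem_iUnion.1 hmem
    exact absurd (hpt t ht x hx S v) (not_le.2 hv))
  have hfinal : 0 ≤ ∫ p in I, (φ (p.1, p.2.2) * ‖h (p.1, p.2.2)‖ ^ 2
      + inner ℝ (p.2.1.1 (spaceGrad φ (p.1, p.2.2))) (h (p.1, p.2.2))
      + traceAlong p.2.1 (spaceDeriv (spaceGrad φ) (p.1, p.2.2))
      - timeDeriv φ (p.1, p.2.2)) ∂lam := by
    refine integral_nonneg_of_ae ?_
    filter_upwards [hae] with p hp
    simp only [mem_iUnion, mem_ofPred_eq, not_exists, not_lt] at hp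
    exact hp _
  have i6 : IntegrableOn (fun p : E n × Grass d n × ℝ =>
      φ (p.1, p.2.2) * ‖h (p.1, p.2.2)‖ ^ 2
        + inner ℝ (p.2.1.1 (spaceGrad φ (p.1, p.2.2))) (h (p.1, p.2.2))) I lam :=
    i1.add i3.integrableOn
  have i7 : IntegrableOn (fun p : E n × Grass d n × ℝ =>
      φ (p.1, p.2.2) * ‖h (p.1, p.2.2)‖ ^ 2
        + inner ℝ (p.2.1.1 (spaceGrad φ (p.1, p.2.2))) (h (p.1, p.2.2))
        + traceAlong p.2.1 (spaceDeriv (spaceGrad φ) (p.1, p.2.2))) I lam :=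
    i6.add i4.integrableOn
  -- After this rewriting the nonnegative integral is exactly minus the right side of Brakke's
  -- inequality.
  rw [integral_sub i7 i5.integrableOn, integral_add i6 i4.integrableOn,
    integral_add i1 i3.integrableOn, hfv] at hfinal
  linarith

end Flow

end BrakkeFlow

/-! ### Barriers for the flow: shrinking balls and strict subsolutions -/

namespace BrakkeFlow

variable {n : ℕ} {a : ℝ} {lam : Measure (E n × Grass (n - 1) n × ℝ)} {μ : ℝ → Measure (E n)}
  {ν : Kernel (E n × ℝ) (Grass (n - 1) n)}

/-- Barrier principle: a quadratic subsolution that is nonpositive on the support of `μ(t₁)`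
inside a spacetime ball, and whose positivity set on the flow does not reach the boundary of the
ball, stays nonpositive on the flow. -/
theorem IsSpacetimeBrakkeFlow.measure_barrier_pos_eq_zero (hn : 1 ≤ n)
    (hflow : IsSpacetimeBrakkeFlow a lam μ ν) {c : ℝ} {q : E n} {A : E n →L[ℝ] E n} {b : ℝ}
    {x₀ : E n} {t₀ : ℝ} (hA : ∀ x y, inner ℝ (A x) y = (inner ℝ x (A y) : ℝ))
    {t₁ t₂ : ℝ} (h₁ : 0 ≤ t₁) (h₁₂ : t₁ < t₂) (h₂ : t₂ ≤ a) (z : E n × ℝ) {r R : ℝ} (hr : 0 < r)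
    (hrR : r < R)
    (hloc : ∀ t ∈ Ico t₁ t₂, ∀ x ∈ (μ t).support, dist (x, t) z ≤ R →
      0 ≤ quadBarrier c q A b x₀ t₀ (x, t) → dist (x, t) z < r)
    (hpde : ∀ t ∈ Ico t₁ t₂, ∀ x ∈ (μ t).support, dist (x, t) z < r →
      0 < quadBarrier c q A b x₀ t₀ (x, t) → ∀ S : Grass (n - 1) n,
      0 ≤ quadBarrier c q A b x₀ t₀ (x, t) * (traceAlong S A - b)
        + ‖S.1 (q + A (x - x₀))‖ ^ 2)
    (hinit : ∀ x ∈ (μ t₁).support, dist (x, t₁) z < R →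
      quadBarrier c q A b x₀ t₀ (x, t₁) ≤ 0) :
    μ t₂ {x | dist (x, t₂) z < r ∧ 0 < quadBarrier c q A b x₀ t₀ (x, t₂)} = 0 := by
  let χ : ContDiffBump z := ⟨r, R, hr, hrR⟩
  set w := quadBarrier c q A b x₀ t₀ with hw
  set φ : E n × ℝ → ℝ := fun p => χ p * cubeBarrier c q A b x₀ t₀ p with hφdef
  have hwc : Continuous w := (contDiff_quadBarrier (k := 0)).continuous
  have hφ : ContDiff ℝ 2 φ := χ.contDiff.mul contDiff_cubeBarrier
  have hc : HasCompactSupport φ := χ.hasCompactSupport.mul_right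
  have hφ0 : ∀ p, 0 ≤ φ p := fun p => mul_nonneg χ.nonneg (pow_nonneg (le_max_right _ _) 3)
  have hle := hflow.integral_le_of_pointwise h₁ h₁₂ h₂ hφ hc hφ0 (by
    intro t ht x hx S v
    by_cases hR : dist (x, t) z ≤ R
    -- The cutoff is invisible on the flow: where `w < 0` the cube vanishes nearby, and where `w ≥
    -- 0` the localization hypothesis puts the point in the region `χ = 1`.
    · have heq : φ =ᶠ[𝓝 (x, t)] cubeBarrier c q A b x₀ t₀ := by
        rcases lt_or_ge (w (x, t)) 0 with hneg | hpos
        · filter_upwards [hwc.continuousAt.eventually_lt_const hneg] with p hp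
          have : cubeBarrier c q A b x₀ t₀ p = 0 := by
            rw [cubeBarrier, max_eq_right hp.le]; norm_num
          simp [hφdef, this]
        · filter_upwards [χ.eventuallyEq_one_of_mem_ball (hloc t ht x hx hR hpos)] with p hp
          simp [hφdef, hp]
      rw [heq.eq_of_nhds, (spaceGrad_congr heq).eq_of_nhds,
        spaceDeriv_congr (spaceGrad_congr heq),
        timeDeriv_congr heq]
      exact cubeBarrier_pointwise hn hA (x, t) S
        (fun h => hpde t ht x hx (hloc t ht x hx hR h.le) h S) v
    · have heq : φ =ᶠ[𝓝 (x, t)] fun _ => 0 := by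
        have : ∀ᶠ p in 𝓝 (x, t), R < dist p z :=
          (continuous_id.dist continuous_const).continuousAt.eventually_const_lt (not_le.1 hR)
        filter_upwards [this] with p hp
        have : χ p = 0 := χ.zero_of_le_dist hp.le
        simp [hφdef, this]
      have hg : spaceGrad (fun _ : E n × ℝ => (0 : ℝ)) = fun _ => 0 := by
        ext1 p; simp [spaceGrad]
      rw [heq.eq_of_nhds, (spaceGrad_congr heq).eq_of_nhds,
        spaceDeriv_congr (spaceGrad_congr heq),
        timeDeriv_congr heq, hg]
      simp [spaceDeriv, timeDeriv, traceAlong])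
  have hzero : ∫ y, φ (y, t₁) ∂(μ t₁) = 0 := by
    refine integral_eq_zero_of_ae ?_
    filter_upwards [Measure.support_mem_ae (μ := μ t₁)] with x hx
    by_cases hR : dist (x, t₁) z < R
    · simp only [hφdef, cubeBarrier]
      rw [max_eq_right (hinit x hx hR)]; simp
    · have : χ (x, t₁) = 0 := χ.zero_of_le_dist (not_lt.1 hR)
      simp [hφdef, this]
  rw [hzero] at hle
  have hfin := hflow.radon t₂ ⟨h₁.trans h₁₂.le, h₂⟩
  have hcont : Continuous fun y => φ (y, t₂) := hφ.continuous.comp (by fun_prop)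
  have hcs : HasCompactSupport fun y => φ (y, t₂) := by
    refine HasCompactSupport.of_support_subset_isCompact (hc.image continuous_fst) ?_
    intro y hy
    exact ⟨(y, t₂), subset_tsupport _ hy, rfl⟩
  have hint : Integrable (fun y => φ (y, t₂)) (μ t₂) := hcont.integrable_of_hasCompactSupport hcs
  have hae := (integral_eq_zero_iff_of_nonneg (fun y => hφ0 _) hint).1
    (le_antisymm hle (integral_nonneg fun y => hφ0 _))
  refine measure_mono_null ?_ (ae_iff.1 hae)
  rintro y ⟨hy1, hy2⟩ hy
  have h1 : χ (y, t₂) = 1 := χ.one_of_mem_closedBall (Metric.mem_closedBall.2 hy1.le)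
  have h2 : φ (y, t₂) = w (y, t₂) ^ 3 := by
    simp only [hφdef, h1, one_mul, cubeBarrier]
    rw [max_eq_left hy2.le]
  have h3 : 0 < w (y, t₂) ^ 3 := pow_pos hy2 3
  rw [← h2] at h3
  exact h3.ne' hy

theorem inner_smul_id_symm (r : ℝ) (x y : E n) :
    inner ℝ ((r • ContinuousLinearMap.id ℝ (E n)) x) y
      = (inner ℝ x ((r • ContinuousLinearMap.id ℝ (E n)) y) : ℝ) := by
  simp [inner_smul_left, inner_smul_right]

/-- Avoidance of shrinking balls. -/
theorem IsSpacetimeBrakkeFlow.measure_half_ball_eq_zero (hn : 1 ≤ n)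
    (hflow : IsSpacetimeBrakkeFlow a lam μ ν) {x₀ : E n} {R t₁ t : ℝ} (hR : 0 < R) (h₁ : 0 ≤ t₁)
    (ht₁ : t₁ ≤ t) (hta : t ≤ a) (ht : 4 * n * (t - t₁) ≤ R ^ 2)
    (hball : μ t₁ (Metric.ball x₀ R) = 0) : μ t (Metric.ball x₀ (R / 2)) = 0 := by
  rcases ht₁.eq_or_lt with rfl | hlt
  · exact measure_mono_null (Metric.ball_subset_ball (by linarith)) hball
  -- The slope `-2n` in time lies strictly below `tr_S A = -2(n - 1)`, so the subsolution inequality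
  -- holds even though the gradient vanishes at `x₀`.
  have hval : ∀ y s, quadBarrier (R ^ 2) 0 ((-2 : ℝ) • ContinuousLinearMap.id ℝ (E n)) (-2 * n) x₀
      t₁ (y, s) = R ^ 2 - ‖y - x₀‖ ^ 2 - 2 * n * (s - t₁) := by
    intro y s
    simp only [quadBarrier, inner_zero_left, smul_apply,
      ContinuousLinearMap.id_apply, inner_smul_left, real_inner_self_eq_norm_sq, conj_trivial]
    ring
  have hdist : ∀ y s, dist (y, s) (x₀, t₁) = max ‖y - x₀‖ |s - t₁| := by
    intro y s
    rw [Prod.dist_eq, dist_eq_norm, Real.dist_eq]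
  have hn0 : (0 : ℝ) ≤ n := Nat.cast_nonneg n
  have key := hflow.measure_barrier_pos_eq_zero hn (c := R ^ 2) (q := 0)
    (A := (-2 : ℝ) • ContinuousLinearMap.id ℝ (E n)) (b := -2 * n) (x₀ := x₀) (t₀ := t₁)
    -- The cutoff radius exceeds both `R` and the time span `a`, so it contains all points of times
    -- in `[t₁, t)` where the barrier is nonnegative.
    (inner_smul_id_symm _) h₁ hlt hta (x₀, t₁) (r := R + a + 1) (R := R + a + 2)
    (by linarith) (by linarith) ?_ ?_ ?_
  · refine measure_mono_null ?_ key
    intro y hy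
    rw [Metric.mem_ball, dist_eq_norm] at hy
    refine ⟨?_, ?_⟩
    · rw [hdist]
      refine max_lt (by linarith) ?_
      rw [abs_of_nonneg (by linarith)]; linarith
    · rw [hval]
      have : ‖y - x₀‖ ^ 2 < (R / 2) ^ 2 := by gcongr
      nlinarith
  · intro s hs x _ _ hx
    rw [hval] at hx
    rw [hdist]
    have h2 : 0 ≤ n * (s - t₁) := mul_nonneg hn0 (by linarith [hs.1])
    have h3 : ‖x - x₀‖ ≤ R := (sq_le_sq₀ (norm_nonneg _) hR.le).1 (by nlinarith)
    refine max_lt (by linarith) ?_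
    rw [abs_of_nonneg (by linarith [hs.1])]; linarith [hs.2]
  · intro s hs x _ _ hx S
    obtain ⟨f, hf1, hf⟩ := S.exists_unit_normal hn
    rw [traceAlong_eq S hf]
    have h1 : LinearMap.trace ℝ (E n) ((-2 : ℝ) • ContinuousLinearMap.id ℝ (E n)).toLinearMap
        = -2 * n := by
      have : ((-2 : ℝ) • ContinuousLinearMap.id ℝ (E n)).toLinearMap = (-2 : ℝ) • LinearMap.id :=
        rfl
      rw [this, map_smul, LinearMap.trace_id]; simp
    have h2 : (inner ℝ f (((-2 : ℝ) • ContinuousLinearMap.id ℝ (E n)) f) : ℝ) = -2 := by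
      simp [inner_smul_right, hf1]
    rw [h1, h2]
    have := mul_nonneg hx.le (show (0 : ℝ) ≤ (-2 * n - -2 - -2 * n) by linarith)
    positivity
  · intro x hx _
    rw [hval]
    have h1 : x ∉ Metric.ball x₀ R := fun h =>
      Measure.subset_compl_support_of_isOpen Metric.isOpen_ball hball h hx
    rw [Metric.mem_ball, dist_eq_norm, not_lt] at h1
    have : R ^ 2 ≤ ‖x - x₀‖ ^ 2 := by gcongr
    linarith

/-- If `μ(t)` vanishes near `x₀` for the times `t ≤ t₀` close to `t₀`, it does so for all times
close to `t₀`. -/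
theorem IsSpacetimeBrakkeFlow.exists_ball_measure_eq_zero (hn : 1 ≤ n)
    (hflow : IsSpacetimeBrakkeFlow a lam μ ν) {x₀ : E n} {t₀ r : ℝ} (hr : 0 < r) (ht₀ : 0 ≤ t₀)
    (h : ∀ t ∈ Icc 0 a, t ∈ Ioc (t₀ - r) t₀ → μ t (Metric.ball x₀ r) = 0) :
    ∃ r' > 0, ∀ t ∈ Icc 0 a, |t - t₀| < r' → μ t (Metric.ball x₀ r') = 0 := by
  have hn0 : (0 : ℝ) < n := by exact_mod_cast hn
  -- Past times are covered by hypothesis. For later ones a ball of radius `r` shrinks to radius `r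
  -- / 2` no sooner than after time `r² / (4n)`.
  refine ⟨min (r / 2) (r ^ 2 / (4 * n)), by positivity, fun t ht htt => ?_⟩
  have h1 := htt.trans_le (min_le_left _ _)
  have h2 := htt.trans_le (min_le_right _ _)
  refine measure_mono_null (Metric.ball_subset_ball (min_le_left _ _)) ?_
  rcases le_total t t₀ with hle | hle
  · refine measure_mono_null (Metric.ball_subset_ball (by linarith)) (h t ht ⟨?_, hle⟩)
    linarith [(abs_lt.1 h1).1]
  · refine hflow.measure_half_ball_eq_zero hn hr ht₀ hle ht.2 ?_
      (h t₀ ⟨ht₀, hle.trans ht.2⟩ ⟨by linarith, le_rfl⟩)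
    rw [abs_of_nonneg (by linarith), lt_div_iff₀ (by positivity)] at h2
    linarith

/-- A strict quadratic subsolution cannot touch the flow from outside at `(x₀, t₀)`. -/
theorem IsSpacetimeBrakkeFlow.exists_ball_measure_eq_zero_of_barrier (hn : 1 ≤ n)
    (hflow : IsSpacetimeBrakkeFlow a lam μ ν) {q : E n} {A : E n →L[ℝ] E n} {b : ℝ}
    {x₀ : E n} {t₀ : ℝ} (hA : ∀ x y, inner ℝ (A x) y = (inner ℝ x (A y) : ℝ)) (hq : q ≠ 0)
    (hb : b * ‖q‖ ^ 2 < LinearMap.trace ℝ (E n) A.toLinearMap * ‖q‖ ^ 2 - inner ℝ q (A q))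
    (ht₀ : 0 < t₀) (hta : t₀ ≤ a) {c r : ℝ} (hc : 0 < c) (hr : 0 < r)
    (htouch : ∀ t ∈ Ico 0 t₀, t₀ - r < t → ∀ x ∈ (μ t).support, ‖x - x₀‖ < r →
      quadBarrier 0 q A b x₀ t₀ (x, t) ≤ - c * (‖x - x₀‖ ^ 2 + (t₀ - t))) :
    ∃ r' > 0, ∀ t ∈ Icc 0 a, |t - t₀| < r' → μ t (Metric.ball x₀ r') = 0 := by
  obtain ⟨d, hd, hbar⟩ := exists_barrier_radius hn q hq A b hb
  set m := min (r / 4) d with hm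
  have hm0 : 0 < m := by positivity
  have hmr : m ≤ r / 4 := min_le_left _ _
  have hmd : m ≤ d := min_le_right _ _
  -- the height of the barrier over the flow
  obtain ⟨σ, hσ0, hσ1, hσ2, hσ3, hσ4⟩ : ∃ σ > 0, σ < t₀ ∧ σ < m ∧ σ < m ^ 2 ∧ c * σ < d := by
    -- The barrier is raised by `c σ` and started at time `t₀ - σ`, which must be positive. On the
    -- flow it is positive only where `|x - x₀|² < σ` and `t₀ - t < σ`, so `σ < m²` and `σ < m`
    -- confine this set to the ball of radius `m`. Finally `c σ < d` bounds its value there, as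
    -- `exists_barrier_radius` requires.
    have h1 : ∀ᶠ σ : ℝ in 𝓝[>] 0, σ < t₀ := nhdsWithin_le_nhds (eventually_lt_nhds ht₀)
    have h2 : ∀ᶠ σ : ℝ in 𝓝[>] 0, σ < m := nhdsWithin_le_nhds (eventually_lt_nhds hm0)
    have h3 : ∀ᶠ σ : ℝ in 𝓝[>] 0, σ < m ^ 2 :=
      nhdsWithin_le_nhds (eventually_lt_nhds (by positivity))
    have h4 : ∀ᶠ σ : ℝ in 𝓝[>] 0, σ < d / c :=
      nhdsWithin_le_nhds (eventually_lt_nhds (by positivity))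
    obtain ⟨σ, ⟨⟨⟨h1, h2⟩, h3⟩, h4⟩, h5⟩ :=
      ((((h1.and h2).and h3).and h4).and self_mem_nhdsWithin).exists
    refine ⟨σ, h5, h1, h2, h3, ?_⟩
    rw [lt_div_iff₀ hc] at h4; linarith
  have hval : ∀ p, quadBarrier (c * σ) q A b x₀ t₀ p = c * σ + quadBarrier 0 q A b x₀ t₀ p := by
    intro p; simp only [quadBarrier]; ring
  have hdist : ∀ y s, dist (y, s) (x₀, t₀) = max ‖y - x₀‖ |s - t₀| := by
    intro y s
    rw [Prod.dist_eq, dist_eq_norm, Real.dist_eq]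
  have hest : ∀ t ∈ Ico (t₀ - σ) t₀, ∀ x ∈ (μ t).support, dist (x, t) (x₀, t₀) ≤ r / 2 →
      quadBarrier (c * σ) q A b x₀ t₀ (x, t) ≤ c * (σ - ‖x - x₀‖ ^ 2 - (t₀ - t)) := by
    intro t ht x hx hdx
    rw [hdist] at hdx
    have h1 := (le_max_left _ _).trans hdx
    have h2 := htouch t ⟨by linarith [ht.1], ht.2⟩ (by linarith [ht.1]) x hx (by linarith)
    rw [hval]; linarith
  have hloc : ∀ t ∈ Ico (t₀ - σ) t₀, ∀ x ∈ (μ t).support, dist (x, t) (x₀, t₀) ≤ r / 2 →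
      0 ≤ quadBarrier (c * σ) q A b x₀ t₀ (x, t) → dist (x, t) (x₀, t₀) < m := by
    intro t ht x hx hdx hpos
    have h1 := nonneg_of_mul_nonneg_right (hpos.trans (hest t ht x hx hdx)) hc
    rw [hdist]
    refine max_lt ?_ ?_
    · refine (sq_lt_sq₀ (norm_nonneg _) hm0.le).1 ?_
      linarith [ht.2]
    · rw [abs_of_nonpos (by linarith [ht.2])]; linarith [ht.1]
  -- The raised barrier is nonpositive on the flow at the starting time but equals `c σ > 0` at
  -- `(x₀, t₀)`. Hence its positivity set, null for every `μ s`, covers a neighbourhood of that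
  -- point up to time `t₀`.
  have hzero : ∀ s ∈ Ioc (t₀ - σ) t₀,
      μ s {x | dist (x, s) (x₀, t₀) < m ∧ 0 < quadBarrier (c * σ) q A b x₀ t₀ (x, s)} = 0 := by
    intro s hs
    have hsub : ∀ t ∈ Ico (t₀ - σ) s, t ∈ Ico (t₀ - σ) t₀ := fun t ht => ⟨ht.1, ht.2.trans_le hs.2⟩
    refine hflow.measure_barrier_pos_eq_zero hn hA (by linarith) hs.1 (hs.2.trans hta) (x₀, t₀)
      (R := r / 2) hm0 (by linarith) (fun t ht => hloc t (hsub t ht)) ?_ ?_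
    · intro t ht x hx hdx hpos S
      have h1 := hest t (hsub t ht) x hx (by linarith)
      rw [hdist] at hdx
      have h2 := (le_max_left _ _).trans_lt hdx
      refine hbar S (x - x₀) (by linarith) _ hpos ?_
      refine h1.trans_lt (lt_of_le_of_lt ?_ hσ4)
      have h3 := (hsub t ht).2
      gcongr
      linarith [sq_nonneg ‖x - x₀‖]
    · intro x hx hdx
      refine (hest _ ⟨le_rfl, by linarith⟩ x hx hdx.le).trans ?_
      have : 0 ≤ c * ‖x - x₀‖ ^ 2 := by positivity
      linarith
  have hcont : Continuous (quadBarrier (c * σ) q A b x₀ t₀) :=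
    (contDiff_quadBarrier (k := 0)).continuous
  have hev : ∀ᶠ p in 𝓝 (x₀, t₀), 0 < quadBarrier (c * σ) q A b x₀ t₀ p := by
    refine hcont.continuousAt.eventually_const_lt ?_
    simp only [quadBarrier]; simp; positivity
  obtain ⟨ρ, hρ0, hρ⟩ := Metric.eventually_nhds_iff.1 hev
  refine hflow.exists_ball_measure_eq_zero hn (r := min (min ρ m) σ) (by positivity) ht₀.le ?_
  intro t _ htt
  have h1 := min_le_left (min ρ m) σ
  have h2 := min_le_right (min ρ m) σ
  have h3 := min_le_left ρ m
  have h4 := min_le_right ρ m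
  refine measure_mono_null ?_ (hzero t ⟨by linarith [htt.1], htt.2⟩)
  intro x hx
  rw [Metric.mem_ball, dist_eq_norm] at hx
  have habs : |t - t₀| < min (min ρ m) σ := by
    rw [abs_of_nonpos (by linarith [htt.2])]; linarith [htt.1]
  have hd : dist (x, t) (x₀, t₀) < min (min ρ m) σ := by rw [hdist]; exact max_lt hx habs
  exact ⟨by linarith, hρ (by linarith)⟩

end BrakkeFlow

/-! ### Second order jets of a classical flow -/

namespace BrakkeFlow

variable {n : ℕ}

/-- The second order Taylor expansion, with the derivatives expressed by a vector and an operator. -/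
theorem eventually_abs_sub_quadBarrier_le {f : E n → ℝ} {g : E n → E n} {A : E n →L[ℝ] E n}
    {y₀ : E n} (hfg : ∀ᶠ y in 𝓝 y₀, HasFDerivAt f (innerSL ℝ (g y)) y) (hg : HasFDerivAt g A y₀)
    (hA : ∀ x y, inner ℝ (A x) y = (inner ℝ x (A y) : ℝ)) (b t₀ : ℝ) {ε : ℝ} (hε : 0 < ε) :
    ∀ᶠ y in 𝓝 y₀, |f y - quadBarrier (f y₀) (g y₀) A b y₀ t₀ (y, t₀)| ≤ ε * ‖y - y₀‖ ^ 2 := by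
  have h1 : ∀ᶠ y in 𝓝 y₀, ‖g y - g y₀ - A (y - y₀)‖ ≤ ε * ‖y - y₀‖ :=
    (hasFDerivAt_iff_isLittleO.1 hg).def hε
  obtain ⟨δ, hδ, h⟩ := Metric.eventually_nhds_iff.1 (hfg.and h1)
  filter_upwards [Metric.ball_mem_nhds y₀ hδ] with y hy
  rw [Metric.mem_ball, dist_eq_norm] at hy
  have hball : ∀ z ∈ Metric.closedBall y₀ ‖y - y₀‖, dist z y₀ < δ := fun z hz =>
    (Metric.mem_closedBall.1 hz).trans_lt hy
  -- Mean value inequality for the remainder on the ball of radius `‖y - y₀‖`, where its gradient is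
  -- at most `ε ‖y - y₀‖`.
  have key := (convex_closedBall y₀ ‖y - y₀‖).norm_image_sub_le_of_norm_hasFDerivWithin_le
    (f := fun z => f z - quadBarrier (f y₀) (g y₀) A b y₀ t₀ (z, t₀))
    (f' := fun z => innerSL ℝ (g z) - innerSL ℝ (g y₀ + A (z - y₀)))
    (C := ε * ‖y - y₀‖) (x := y₀) (y := y)
    (fun z hz => ((h (hball z hz)).1.sub (hasFDerivAt_quadBarrier_space hA z t₀)).hasFDerivWithinAt)
    (fun z hz => ?_) (Metric.mem_closedBall_self (norm_nonneg _))
    (by rw [Metric.mem_closedBall, dist_eq_norm])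
  · have h0 : quadBarrier (f y₀) (g y₀) A b y₀ t₀ (y₀, t₀) = f y₀ := by simp [quadBarrier]
    rw [h0, sub_self, sub_zero, Real.norm_eq_abs] at key
    linarith
  · rw [← map_sub, innerSL_apply_norm]
    have h2 := (h (hball z hz)).2
    rw [Metric.mem_closedBall, dist_eq_norm] at hz
    rw [show g z - (g y₀ + A (z - y₀)) = g z - g y₀ - A (z - y₀) by abel]
    exact h2.trans (by gcongr)

/-- `u` describes the spacetime track of `Γ` near `(y₀, t₀)` as its zero set for times in `(0, T]`,
and has the parabolic second order jet `(q, A, b)` at `(y₀, t₀)`, which satisfies the level set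
equation of mean curvature flow. -/
structure IsLevelSetJet (T : ℝ) (Γ : ℝ → Set (E n)) (y₀ : E n) (t₀ : ℝ) (u : E n × ℝ → ℝ)
    (q : E n) (A : E n →L[ℝ] E n) (b : ℝ) : Prop where
  grad_ne_zero : q ≠ 0
  symm : ∀ x y, inner ℝ (A x) y = (inner ℝ x (A y) : ℝ)
  equation : b * ‖q‖ ^ 2 = LinearMap.trace ℝ (E n) A.toLinearMap * ‖q‖ ^ 2 - inner ℝ q (A q)
  mem_iff : ∀ᶠ p in 𝓝 (y₀, t₀), p.2 ∈ Ioc 0 T → (p.1 ∈ Γ p.2 ↔ u p = 0)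
  continuousAt : ∀ᶠ p in 𝓝 (y₀, t₀), ContinuousAt (fun y => u (y, p.2)) p.1
  expansion : ∀ ε > 0, ∀ᶠ p in 𝓝 (y₀, t₀),
    |u p - quadBarrier 0 q A b y₀ t₀ p| ≤ ε * (‖p.1 - y₀‖ ^ 2 + |p.2 - t₀|)
  hasStrictFDerivAt : HasStrictFDerivAt (fun y => u (y, t₀)) (innerSL ℝ q) y₀

/-- Allows the sign of the defining function to be chosen freely; mean curvature flow is indifferent
to orientation. -/
theorem IsLevelSetJet.neg {T : ℝ} {Γ : ℝ → Set (E n)} {y₀ : E n} {t₀ : ℝ} {u : E n × ℝ → ℝ}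
    {q : E n} {A : E n →L[ℝ] E n} {b : ℝ} (h : IsLevelSetJet T Γ y₀ t₀ u q A b) :
    IsLevelSetJet T Γ y₀ t₀ (fun p => - u p) (-q) (-A) (-b) where
  grad_ne_zero := neg_ne_zero.2 h.grad_ne_zero
  symm x y := by simp [h.symm]
  equation := by
    have h1 : (-A).toLinearMap = - A.toLinearMap := rfl
    rw [h1, map_neg]
    simp only [norm_neg, neg_apply, map_neg, inner_neg_left, inner_neg_right]
    linarith [h.equation]
  mem_iff := by
    filter_upwards [h.mem_iff] with p hp hpt
    rw [hp hpt, neg_eq_zero]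
  continuousAt := by
    filter_upwards [h.continuousAt] with p hp
    exact hp.neg
  expansion ε hε := by
    filter_upwards [h.expansion ε hε] with p hp
    have : -u p - quadBarrier 0 (-q) (-A) (-b) y₀ t₀ p
        = -(u p - quadBarrier 0 q A b y₀ t₀ p) := by
      simp only [quadBarrier, neg_apply, inner_neg_left]; ring
    rwa [this, abs_neg]
  hasStrictFDerivAt := by
    rw [map_neg]
    exact h.hasStrictFDerivAt.fun_neg

/-- The divergence of the unit normal in terms of gradient and Hessian. It turns the geometric
equation of the flow into the scalar identity `b |q|² = tr A |q|² - ⟨q, A q⟩`. -/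
theorem trace_fderiv_normalized {g : E n → E n} {A : E n →L[ℝ] E n} {y₀ : E n}
    (hg : HasFDerivAt g A y₀) (h0 : g y₀ ≠ 0) :
    LinearMap.trace ℝ (E n) (fderiv ℝ (fun y => ‖g y‖⁻¹ • g y) y₀).toLinearMap
      = ‖g y₀‖⁻¹ * LinearMap.trace ℝ (E n) A.toLinearMap
        - (‖g y₀‖ ^ 3)⁻¹ * inner ℝ (g y₀) (A (g y₀)) := by
  have hq : 0 < ‖g y₀‖ := norm_pos_iff.2 h0
  have h1 : HasFDerivAt (fun y => ‖g y‖ ^ 2) (2 • (innerSL ℝ (g y₀)).comp A) y₀ := hg.norm_sq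
  have h2 := h1.sqrt (by positivity)
  have h3 : HasFDerivAt (fun y => ‖g y‖) (‖g y₀‖⁻¹ • (innerSL ℝ (g y₀)).comp A) y₀ := by
    simp only [Real.sqrt_sq (norm_nonneg _)] at h2
    refine h2.congr_fderiv ?_
    ext v
    simp
    field_simp
  have h4 := (hasDerivAt_inv hq.ne').comp_hasFDerivAt y₀ h3
  have h5 := h4.smul hg
  have h6 : fderiv ℝ (fun y => ‖g y‖⁻¹ • g y) y₀ = ‖g y₀‖⁻¹ • A +
      ((-(‖g y₀‖ ^ 3)⁻¹) • (innerSL ℝ (g y₀)).comp A).smulRight (g y₀) := by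
    refine Eq.trans h5.fderiv ?_
    ext1 v
    simp [smul_smul]
    congr 1
    field_simp
  have h7 : (‖g y₀‖⁻¹ • A +
      ((-(‖g y₀‖ ^ 3)⁻¹) • (innerSL ℝ (g y₀)).comp A).smulRight (g y₀)).toLinearMap
      = ‖g y₀‖⁻¹ • A.toLinearMap +
        ((-(‖g y₀‖ ^ 3)⁻¹) • (innerSL ℝ (g y₀)).comp A).toLinearMap.smulRight (g y₀) := rfl
  rw [h6, h7, map_add, map_smul, LinearMap.trace_smulRight]
  simp
  ring

/-- The Riesz isomorphism from the dual of `ℝⁿ` to `ℝⁿ` as a linear map. -/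
noncomputable def rieszInverse (n : ℕ) : StrongDual ℝ (E n) →L[ℝ] E n where
  toFun := (InnerProductSpace.toDual ℝ (E n)).symm
  map_add' x y := map_add _ x y
  map_smul' c x := by simp
  cont := (InnerProductSpace.toDual ℝ (E n)).symm.continuous

theorem IsMeanCurvatureFlow.exists_isLevelSetJet {T : ℝ} {M : Set (E n)} {Γ : ℝ → Set (E n)}
    (hΓ : IsMeanCurvatureFlow T M Γ) {t₀ : ℝ} (ht₀ : t₀ ∈ Ioc 0 T) {y₀ : E n} (hy₀ : y₀ ∈ Γ t₀) :
    ∃ u q A b, IsLevelSetJet T Γ y₀ t₀ u q A b := by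
  obtain ⟨W, hWo, hW, u, hu, hgrad, hzero⟩ := hΓ.classical t₀ ht₀ y₀ hy₀
  set f : E n → ℝ := fun y => u (y, t₀) with hf
  set g : E n → E n := fun y => spaceGrad u (y, t₀) with hg
  have hf2 : ContDiffAt ℝ 2 f y₀ := hu.contDiffAt_space _ hW
  have hgf : ∀ y, innerSL ℝ (g y) = fderiv ℝ f y := by
    intro y
    exact (InnerProductSpace.toDual ℝ (E n)).apply_symm_apply (fderiv ℝ f y)
  have hdf : DifferentiableAt ℝ (fderiv ℝ f) y₀ :=
    (hf2.fderiv_right (m := 1) (by norm_num)).differentiableAt (by simp)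
  set A : E n →L[ℝ] E n :=
    (rieszInverse n) ∘L (fderiv ℝ (fderiv ℝ f) y₀) with hAdef
  have hgA : HasFDerivAt g A y₀ := by
    exact (rieszInverse n).hasFDerivAt.comp y₀ hdf.hasFDerivAt
  have hAinner : ∀ x y, inner ℝ (A x) y = fderiv ℝ (fderiv ℝ f) y₀ x y := by
    intro x y
    exact InnerProductSpace.toDual_symm_apply (𝕜 := ℝ) (E := E n)
  have hsymm : ∀ x y, inner ℝ (A x) y = (inner ℝ x (A y) : ℝ) := by
    intro x y
    rw [← real_inner_comm x (A y), hAinner, hAinner]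
    exact (hf2.isSymmSndFDerivAt (by simp)).eq x y
  have hev : ∀ᶠ y in 𝓝 y₀, HasFDerivAt f (innerSL ℝ (g y)) y := by
    filter_upwards [hf2.eventually (by simp)] with y hy
    rw [hgf]
    exact (hy.differentiableAt (by simp)).hasFDerivAt
  have hq : g y₀ ≠ 0 := hgrad _ hW
  have hf0 : f y₀ = 0 := ((hzero _ hW ht₀).1).1 hy₀
  refine ⟨u, g y₀, A, timeDeriv u (y₀, t₀), hq, hsymm, ?_, ?_, ?_, ?_, ?_⟩
  · have h1 := (hzero _ hW ht₀).2 hf0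
    have h2 : spaceDeriv (unitNormal u) (y₀, t₀) = fderiv ℝ (fun y => ‖g y‖⁻¹ • g y) y₀ := rfl
    rw [normalVelocity, meanCurvatureVector, unitNormal, h2, trace_fderiv_normalized hgA hq,
      smul_smul] at h1
    have h3 := smul_left_injective ℝ hq h1
    have h4 : 0 < ‖g y₀‖ := norm_pos_iff.2 hq
    change -(timeDeriv u (y₀, t₀) / ‖g y₀‖ ^ 2) = _ * ‖g y₀‖⁻¹ at h3
    field_simp at h3
    linarith
  · filter_upwards [hWo.mem_nhds hW] with p hp hpt
    exact (hzero p hp hpt).1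
  · filter_upwards [hWo.mem_nhds hW] with p hp
    exact (hu.contDiffAt_space p hp).continuousAt
  · intro ε hε
    have hsp := eventually_abs_sub_quadBarrier_le hev hgA hsymm (timeDeriv u (y₀, t₀)) t₀ hε
    have htc : ∀ᶠ p in 𝓝 (y₀, t₀), |timeDeriv u p - timeDeriv u (y₀, t₀)| < ε := by
      have h1 := hu.continuousOn_timeDeriv.continuousAt (hWo.mem_nhds hW)
      exact Metric.tendsto_nhds.1 h1 ε hε
    obtain ⟨δ, hδ, hball⟩ := Metric.eventually_nhds_iff.1 (htc.and (hWo.mem_nhds hW))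
    have hfst : ∀ᶠ p : E n × ℝ in 𝓝 (y₀, t₀),
        |f p.1 - quadBarrier (f y₀) (g y₀) A (timeDeriv u (y₀, t₀)) y₀ t₀ (p.1, t₀)|
          ≤ ε * ‖p.1 - y₀‖ ^ 2 := (continuous_fst.tendsto (y₀, t₀)).eventually hsp
    filter_upwards [hfst, Metric.ball_mem_nhds (y₀, t₀) hδ] with p hp hpb
    rw [Metric.mem_ball, Prod.dist_eq, max_lt_iff] at hpb
    -- Since `u` is only `C^{2,1}`, the expansion is split: the time `p.2` is moved to `t₀` at the
    -- fixed point `p.1`, using continuity of `∂ₜu`, and the spatial Taylor expansion is used only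
    -- at time `t₀`.
    have key := (convex_ball t₀ δ).norm_image_sub_le_of_norm_hasDerivWithin_le
      (f := fun s => u (p.1, s) - timeDeriv u (y₀, t₀) * s)
      (f' := fun s => timeDeriv u (p.1, s) - timeDeriv u (y₀, t₀)) (C := ε) (x := t₀) (y := p.2)
      (fun s hs => ?_) (fun s hs => ?_) (Metric.mem_ball_self hδ) hpb.2
    · have e : u p - quadBarrier 0 (g y₀) A (timeDeriv u (y₀, t₀)) y₀ t₀ p
          = (u (p.1, p.2) - timeDeriv u (y₀, t₀) * p.2
              - (u (p.1, t₀) - timeDeriv u (y₀, t₀) * t₀))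
            + (f p.1 - quadBarrier (f y₀) (g y₀) A (timeDeriv u (y₀, t₀)) y₀ t₀ (p.1, t₀)) := by
        rw [hf0]; simp only [quadBarrier, hf]; ring
      rw [e]
      rw [Real.norm_eq_abs, Real.norm_eq_abs] at key
      exact (abs_add_le _ _).trans (by linarith)
    · have hs' : dist (p.1, s) (y₀, t₀) < δ := by
        rw [Prod.dist_eq]; exact max_lt hpb.1 hs
      have h1 := (hu.differentiableAt_time _ (hball hs').2).hasDerivAt
      have h2 := (hasDerivAt_id s).const_mul (timeDeriv u (y₀, t₀))
      rw [mul_one] at h2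
      exact (h1.sub h2).hasDerivWithinAt
    · have hs' : dist (p.1, s) (y₀, t₀) < δ := by
        rw [Prod.dist_eq]; exact max_lt hpb.1 hs
      exact (hball hs').1.le
  · rw [hgf]
    exact hf2.hasStrictFDerivAt (by simp)

end BrakkeFlow

namespace BrakkeFlow

variable {n : ℕ} {a T : ℝ} {lam : Measure (E n × Grass (n - 1) n × ℝ)} {μ : ℝ → Measure (E n)}
  {ν : Kernel (E n × ℝ) (Grass (n - 1) n)} {M : Set (E n)} {Γ : ℝ → Set (E n)}

/-! ### Crossing a moving hypersurface -/

/-- Moving in a direction `e` along which `u` decreases makes `u` nonpositive within a short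
distance, so by the intermediate value theorem a path starting where `u ≥ 0` crosses the
hypersurface. -/
theorem IsLevelSetJet.eventually_exists_mem {y₀ : E n} {t₀ : ℝ} {u : E n × ℝ → ℝ}
    {q : E n} {A : E n →L[ℝ] E n} {b : ℝ} (h : IsLevelSetJet T Γ y₀ t₀ u q A b) {e : E n}
    (he : inner ℝ q e < (0 : ℝ)) {η : ℝ} (hη : 0 < η) :
    ∀ᶠ p in 𝓝 (y₀, t₀), p.2 ∈ Ioc 0 T → 0 ≤ u p → ∃ s ∈ Icc 0 η, p.1 + s • e ∈ Γ p.2 := by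
  -- The jet only records continuity of `u` in space. The upper bound `Ψ` from the expansion is
  -- jointly continuous, so its sign at the end of the step persists for nearby starting points.
  let Ψ : E n × ℝ → ℝ := fun p =>
    quadBarrier 0 q A b y₀ t₀ p + 1 * (‖p.1 - y₀‖ ^ 2 + |p.2 - t₀|)
  have hΨ : Continuous Ψ := by
    have := (contDiff_quadBarrier (k := 0) (c := 0) (q := q) (A := A) (b := b) (x₀ := y₀)
      (t₀ := t₀)).continuous
    fun_prop
  have hP := (h.mem_iff.and h.continuousAt).and (h.expansion 1 one_pos)
  let G : (E n × ℝ) × ℝ → E n × ℝ := fun r => (r.1.1 + r.2 • e, r.1.2)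
  have hG : Continuous G := by fun_prop
  have hG0 : G ((y₀, t₀), 0) = (y₀, t₀) := by simp [G]
  have hev : ∀ᶠ r in 𝓝 ((y₀, t₀), (0 : ℝ)), _ :=
    (hG.tendsto' ((y₀, t₀), 0) (y₀, t₀) hG0).eventually hP
  obtain ⟨δ, hδ, hball⟩ := Metric.eventually_nhds_iff.1 hev
  -- a small step `σ` along `e` at which `Ψ` is negative
  obtain ⟨σ, hσ0, hση, hσδ, hσΨ⟩ : ∃ σ > 0, σ < η ∧ σ < δ ∧ Ψ (y₀ + σ • e, t₀) < 0 := by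
    have h1 : ∀ᶠ σ : ℝ in 𝓝 0, inner ℝ q e + σ * (1 / 2 * inner ℝ (A e) e + ‖e‖ ^ 2) < 0 := by
      have : Continuous fun σ : ℝ => inner ℝ q e + σ * (1 / 2 * inner ℝ (A e) e + ‖e‖ ^ 2) := by
        fun_prop
      exact this.continuousAt.eventually_lt_const (by simpa using he)
    have h2 : ∀ᶠ σ : ℝ in 𝓝[>] 0, _ := nhdsWithin_le_nhds
      ((h1.and (eventually_lt_nhds hη)).and (eventually_lt_nhds hδ))
    obtain ⟨σ, ⟨⟨h1, h2⟩, h3⟩, h4⟩ := (h2.and self_mem_nhdsWithin).exists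
    refine ⟨σ, h4, h2, h3, ?_⟩
    have : Ψ (y₀ + σ • e, t₀)
        = σ * (inner ℝ q e + σ * (1 / 2 * inner ℝ (A e) e + ‖e‖ ^ 2)) := by
      simp only [Ψ, quadBarrier, add_sub_cancel_left, map_smul, inner_smul_left, inner_smul_right,
        norm_smul, sub_self, abs_zero, mul_pow, conj_trivial, Real.norm_eq_abs, sq_abs]
      ring
    rw [this]
    exact mul_neg_of_pos_of_neg h4 h1
  have hneg : ∀ᶠ p : E n × ℝ in 𝓝 (y₀, t₀), Ψ (G (p, σ)) < 0 := by
    have : Continuous fun p : E n × ℝ => Ψ (G (p, σ)) := by fun_prop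
    exact this.continuousAt.eventually_lt_const hσΨ
  filter_upwards [hneg, Metric.ball_mem_nhds (y₀, t₀) hδ] with p hp hpb hpT hpos
  have hnear : ∀ s ∈ Icc 0 σ, dist (p, s) ((y₀, t₀), (0 : ℝ)) < δ := by
    intro s hs
    rw [Prod.dist_eq]
    refine max_lt hpb ?_
    rw [Real.dist_eq, sub_zero, abs_of_nonneg hs.1]
    exact hs.2.trans_lt hσδ
  have hcont : ContinuousOn (fun s : ℝ => u (p.1 + s • e, p.2)) (Icc 0 σ) := by
    intro s hs
    have h1 : ContinuousAt (fun y => u (y, p.2)) (p.1 + s • e) := (hball (hnear s hs)).1.2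
    have h2 : ContinuousAt (fun s : ℝ => p.1 + s • e) s := by fun_prop
    exact (ContinuousAt.comp (f := fun s : ℝ => p.1 + s • e) h1 h2).continuousWithinAt
  have hend : u (p.1 + σ • e, p.2) ≤ 0 := by
    have h1 : |u (G (p, σ)) - quadBarrier 0 q A b y₀ t₀ (G (p, σ))|
      ≤ 1 * (‖(G (p, σ)).1 - y₀‖ ^ 2 + |(G (p, σ)).2 - t₀|) := (hball (hnear σ ⟨hσ0.le, le_rfl⟩)).2
    have h2 := (abs_le.1 h1).2
    change u (G (p, σ)) ≤ 0
    simp only [Ψ] at hp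
    linarith
  obtain ⟨s, hs, hs0⟩ := intermediate_value_Icc' hσ0.le hcont
    (show (0 : ℝ) ∈ Icc _ _ from ⟨hend, by simpa using hpos⟩)
  refine ⟨s, ⟨hs.1, hs.2.trans hση.le⟩, ?_⟩
  exact ((hball (hnear s hs)).1.1 hpT).2 hs0

/-- Points of a classical flow persist to nearby times. -/
theorem IsMeanCurvatureFlow.eventually_exists_mem (hΓ : IsMeanCurvatureFlow T M Γ) {t₀ : ℝ}
    (ht₀ : t₀ ∈ Ioc 0 T) {y₀ : E n} (hy₀ : y₀ ∈ Γ t₀) {η : ℝ} (hη : 0 < η) :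
    ∀ᶠ t in 𝓝 t₀, t ∈ Ioc 0 T → ∃ y ∈ Γ t, ‖y - y₀‖ ≤ η := by
  obtain ⟨u, q, A, b, h⟩ := hΓ.exists_isLevelSetJet ht₀ hy₀
  have hq : 0 < ‖q‖ := norm_pos_iff.2 h.grad_ne_zero
  have hη' : 0 < η / ‖q‖ := by positivity
  -- The sign of `u (y₀, t)` is unknown: if it is nonnegative move along `-q`, otherwise along `q`
  -- with `-u`.
  have h1 := h.eventually_exists_mem (e := -q)
    (by rw [inner_neg_right, real_inner_self_eq_norm_sq]; nlinarith) hη'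
  have h2 := h.neg.eventually_exists_mem (e := q)
    (by rw [inner_neg_left, real_inner_self_eq_norm_sq]; nlinarith) hη'
  have hc : Tendsto (fun t : ℝ => (y₀, t)) (𝓝 t₀) (𝓝 (y₀, t₀)) :=
    Continuous.tendsto (by fun_prop) t₀
  filter_upwards [hc.eventually h1, hc.eventually h2] with t h1 h2 ht
  have hnorm : ∀ s ∈ Icc 0 (η / ‖q‖), |s| * ‖q‖ ≤ η := by
    intro s hs
    rw [abs_of_nonneg hs.1, ← le_div_iff₀ hq]
    exact hs.2
  rcases le_total 0 (u (y₀, t)) with h | h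
  · obtain ⟨s, hs, hmem⟩ := h1 ht h
    refine ⟨_, hmem, ?_⟩
    simpa [norm_smul] using hnorm s hs
  · obtain ⟨s, hs, hmem⟩ := h2 ht (neg_nonneg.2 h)
    refine ⟨_, hmem, ?_⟩
    simpa [norm_smul] using hnorm s hs

/-- At a nearest point the spatial gradient of a defining function can be chosen to point away
from the exterior point. -/
theorem IsMeanCurvatureFlow.exists_isLevelSetJet_of_nearest (hΓ : IsMeanCurvatureFlow T M Γ)
    {t₀ : ℝ} (ht₀ : t₀ ∈ Ioc 0 T) {x₀ y₀ : E n} (hy₀ : y₀ ∈ Γ t₀) (hne : x₀ ≠ y₀)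
    (hmin : ∀ y ∈ Γ t₀, ‖x₀ - y₀‖ ≤ ‖x₀ - y‖) :
    ∃ u q A b, IsLevelSetJet T Γ y₀ t₀ u q A b ∧ q = -(‖q‖ / ‖x₀ - y₀‖) • (x₀ - y₀) := by
  obtain ⟨u, q, A, b, h⟩ := hΓ.exists_isLevelSetJet ht₀ hy₀
  have hR : 0 < ‖x₀ - y₀‖ := norm_pos_iff.2 (sub_ne_zero.2 hne)
  have hu0 : u (y₀, t₀) = 0 := (h.mem_iff.self_of_nhds ht₀).1 hy₀
  have hev : ∀ᶠ y in 𝓝 y₀, (y ∈ Γ t₀ ↔ u (y, t₀) = 0) := by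
    have hc : Tendsto (fun y : E n => (y, t₀)) (𝓝 y₀) (𝓝 (y₀, t₀)) :=
      Continuous.tendsto (by fun_prop) y₀
    filter_upwards [hc.eventually h.mem_iff] with y hy
    exact hy ht₀
  have hext : IsLocalExtrOn (fun y => ‖x₀ - y‖ ^ 2) {y | u (y, t₀) = u (y₀, t₀)} y₀ := by
    left
    have : ∀ᶠ y in 𝓝[{y | u (y, t₀) = u (y₀, t₀)}] y₀, ‖x₀ - y₀‖ ^ 2 ≤ ‖x₀ - y‖ ^ 2 := by
      filter_upwards [nhdsWithin_le_nhds hev, self_mem_nhdsWithin] with y hy hmem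
      have h1 : u (y, t₀) = u (y₀, t₀) := hmem
      have := hmin y (hy.2 (h1.trans hu0))
      gcongr
    exact this
  have hφ : HasStrictFDerivAt (fun y => ‖x₀ - y‖ ^ 2)
      ((2 • innerSL ℝ (x₀ - y₀)).comp (-ContinuousLinearMap.id ℝ (E n))) y₀ :=
    (hasStrictFDerivAt_norm_sq (x₀ - y₀)).comp y₀ ((hasStrictFDerivAt_id y₀).const_sub x₀)
  -- Lagrange multipliers for the distance to `x₀` on the level set: `q` is parallel to `x₀ - y₀`.
  obtain ⟨α, β, hαβ, heq⟩ :=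
    hext.exists_multipliers_of_hasStrictFDerivAt_1d h.hasStrictFDerivAt hφ
  have hvec : α • q = (2 * β) • (x₀ - y₀) := by
    refine ext_inner_right ℝ fun v => ?_
    have := congrArg (fun L : StrongDual ℝ (E n) => L v) heq
    simp only [add_apply, smul_apply, ContinuousLinearMap.comp_apply, neg_apply,
      ContinuousLinearMap.id_apply, innerSL_apply_apply, inner_neg_right, zero_apply,
      smul_eq_mul, nsmul_eq_mul] at this
    rw [inner_smul_left, inner_smul_left]
    simp only [conj_trivial]
    push_cast at this
    linarith
  have hq : 0 < ‖q‖ := norm_pos_iff.2 h.grad_ne_zero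
  have hα : α ≠ 0 := by
    rintro rfl
    rw [zero_smul] at hvec
    have hβ : β ≠ 0 := by
      rintro rfl; simp at hαβ
    exact (smul_ne_zero (mul_ne_zero two_ne_zero hβ) (sub_ne_zero.2 hne)) hvec.symm
  have hqv : q = (α⁻¹ * (2 * β)) • (x₀ - y₀) := by
    rw [← smul_smul, ← hvec, smul_smul, inv_mul_cancel₀ hα, one_smul]
  set k := α⁻¹ * (2 * β)
  have hk : ‖q‖ = |k| * ‖x₀ - y₀‖ := by rw [hqv, norm_smul, Real.norm_eq_abs]
  have hk' : ‖q‖ / ‖x₀ - y₀‖ = |k| := by rw [hk]; field_simp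
  rcases le_total k 0 with hk0 | hk0
  · refine ⟨u, q, A, b, h, ?_⟩
    rw [hk', abs_of_nonpos hk0, neg_neg, ← hqv]
  · refine ⟨_, _, _, _, h.neg, ?_⟩
    rw [norm_neg, hk', abs_of_nonneg hk0, neg_smul, ← hqv]

/-! ### Touching points -/

theorem measure_ball_eq_zero_of_forall_notMem_support {m : Measure (E n)} {x₀ : E n} {r : ℝ}
    (h : ∀ x, ‖x - x₀‖ < r → x ∉ m.support) : m (Metric.ball x₀ r) = 0 := by
  refine measure_mono_null (fun x hx => ?_) Measure.measure_compl_support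
  exact h x (by rwa [Metric.mem_ball, dist_eq_norm] at hx)

/-- If `μ(t)` vanishes near `x₀` for the times `t < t₀` close to `t₀ > 0`, it does so for all
times close to `t₀`. -/
theorem IsSpacetimeBrakkeFlow.exists_ball_measure_eq_zero_of_past (hn : 1 ≤ n)
    (hflow : IsSpacetimeBrakkeFlow a lam μ ν) {x₀ : E n} {t₀ r : ℝ} (hr : 0 < r) (ht₀ : 0 < t₀)
    (h : ∀ t ∈ Ico 0 t₀, t₀ - r < t → μ t (Metric.ball x₀ r) = 0) :
    ∃ r' > 0, ∀ t ∈ Icc 0 a, |t - t₀| < r' → μ t (Metric.ball x₀ r') = 0 := by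
  have hn0 : (0 : ℝ) < n := by exact_mod_cast hn
  -- The shrinking ball starts at `t₀ - s` and may run up to `t₀ + s`; the elapsed time `2 s`
  -- explains the `8`.
  set s := min (min (r / 2) t₀) (r ^ 2 / (8 * n)) with hs
  have hs0 : 0 < s := by positivity
  have hs1 : s ≤ r / 2 := (min_le_left _ _).trans (min_le_left _ _)
  have hs2 : s ≤ t₀ := (min_le_left _ _).trans (min_le_right _ _)
  have hs3 : s ≤ r ^ 2 / (8 * n) := min_le_right _ _
  rw [le_div_iff₀ (by positivity)] at hs3
  refine ⟨s, hs0, fun t ht htt => ?_⟩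
  obtain ⟨h1, h2⟩ := abs_lt.1 htt
  refine measure_mono_null (Metric.ball_subset_ball hs1) ?_
  refine hflow.measure_half_ball_eq_zero hn hr (t₁ := t₀ - s) (by linarith) (by linarith) ht.2 ?_
    (h _ ⟨by linarith, by linarith⟩ (by linarith))
  have : n * (t - (t₀ - s)) ≤ n * (2 * s) := by gcongr; linarith
  linarith

/-- The case of a point at less than the critical distance from the classical flow. -/
theorem exists_ball_measure_eq_zero_of_dist_lt (hn : 1 ≤ n)
    (hflow : IsSpacetimeBrakkeFlow a lam μ ν) (hΓ : IsMeanCurvatureFlow T M Γ)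
    {t₀ ε R : ℝ} (ht₀ : t₀ ∈ Ioc 0 T) (hε : 0 < ε) {x₀ y₀ : E n} (hy₀ : y₀ ∈ Γ t₀)
    (hlt : ‖x₀ - y₀‖ < R)
    (hfar : ∀ t ∈ Ico 0 t₀, ∀ x ∈ (μ t).support, ∀ y ∈ Γ t, R + ε * (t₀ - t) < ‖x - y‖) :
    ∃ r' > 0, ∀ t ∈ Icc 0 a, |t - t₀| < r' → μ t (Metric.ball x₀ r') = 0 := by
  set η := (R - ‖x₀ - y₀‖) / 2 with hη
  have hη0 : 0 < η := by linarith
  obtain ⟨δ, hδ, h⟩ := Metric.eventually_nhds_iff.1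
    ((hΓ.eventually_exists_mem ht₀ hy₀ hη0).and (eventually_gt_nhds ht₀.1))
  refine hflow.exists_ball_measure_eq_zero_of_past hn (r := min δ η) (by positivity) ht₀.1 ?_
  intro t ht htt
  refine measure_ball_eq_zero_of_forall_notMem_support fun x hx hmem => ?_
  have h1 := min_le_left δ η
  have h2 := min_le_right δ η
  obtain ⟨hy, ht0⟩ := h (y := t) (by
    rw [Real.dist_eq, abs_of_nonpos (by linarith [ht.2])]; linarith)
  obtain ⟨y, hyΓ, hyn⟩ := hy ⟨ht0, ht.2.le.trans ht₀.2⟩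
  have h3 := hfar t ht x hmem y hyΓ
  have h4 : 0 < ε * (t₀ - t) := mul_pos hε (by linarith [ht.2])
  have h5 : ‖x - y‖ ≤ ‖x - x₀‖ + ‖x₀ - y₀‖ + ‖y - y₀‖ := by
    rw [show x - y = (x - x₀) + (x₀ - y₀) - (y - y₀) by abel]
    exact (norm_sub_le _ _).trans (by gcongr; exact norm_add_le _ _)
  linarith

/-- Translating the jet of a moving hypersurface along its normal, with extra speed `ε` away from
the flow, produces a strict barrier. -/
theorem quadBarrier_translate_le {q v ξ : E n} {A : E n →L[ℝ] E n} {b ε κ τ : ℝ}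
    {x₀ y₀ : E n} {t₀ R : ℝ} (hA : ∀ x y, inner ℝ (A x) y = (inner ℝ x (A y) : ℝ))
    (hv : ‖v‖ = 1) (hq : inner ℝ q v = -‖q‖) (hxy : x₀ = y₀ + R • v) (hε : 0 < ε) (hκ : 0 < κ)
    (hτ : 0 < τ)
    (hsmall : ε * ‖A‖ * ‖ξ‖ + 1 / 2 * ε ^ 2 * τ * ‖A‖ + 2 * κ * ε ^ 2 * τ ≤ κ)
    (h : quadBarrier 0 q A b y₀ t₀ (x₀ + ξ - (R + ε * τ) • v, t₀ - τ)
      ≤ κ * (‖x₀ + ξ - (R + ε * τ) • v - y₀‖ ^ 2 + τ)) :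
    quadBarrier 0 q (A + (-(6 * κ)) • ContinuousLinearMap.id ℝ (E n)) (b - ε * ‖q‖ + 4 * κ) x₀ t₀
      (x₀ + ξ, t₀ - τ) ≤ -κ * (‖ξ‖ ^ 2 + τ) := by
  have hz : x₀ + ξ - (R + ε * τ) • v - y₀ = ξ - (ε * τ) • v := by
    rw [hxy, add_smul]; abel
  have hsq : ‖ξ - (ε * τ) • v‖ ^ 2 ≤ 2 * ‖ξ‖ ^ 2 + 2 * (ε * τ) ^ 2 := by
    have h1 := norm_sub_le ξ ((ε * τ) • v)
    rw [norm_smul, hv, mul_one, Real.norm_eq_abs, abs_of_pos (by positivity)] at h1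
    have h2 : ‖ξ - (ε * τ) • v‖ ^ 2 ≤ (‖ξ‖ + ε * τ) ^ 2 := by gcongr
    nlinarith [sq_nonneg (‖ξ‖ - ε * τ)]
  have hAξ : |(inner ℝ (A ξ) v : ℝ)| ≤ ‖A‖ * ‖ξ‖ := by
    have := abs_real_inner_le_norm (A ξ) v
    rw [hv, mul_one] at this
    exact this.trans (A.le_opNorm ξ)
  have hAv : |(inner ℝ (A v) v : ℝ)| ≤ ‖A‖ := by
    have := abs_real_inner_le_norm (A v) v
    rw [hv, mul_one] at this
    have h2 := A.le_opNorm v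
    rw [hv, mul_one] at h2
    exact this.trans h2
  have e1 : quadBarrier 0 q A b y₀ t₀ (x₀ + ξ - (R + ε * τ) • v, t₀ - τ)
      = inner ℝ q ξ + ε * τ * ‖q‖ + 1 / 2 * inner ℝ (A ξ) ξ - ε * τ * inner ℝ (A ξ) v
        + 1 / 2 * (ε * τ) ^ 2 * inner ℝ (A v) v - b * τ := by
    have hsym : (inner ℝ (A v) ξ : ℝ) = inner ℝ (A ξ) v := by rw [hA, real_inner_comm]
    simp only [quadBarrier, hz, map_sub, map_smul, inner_sub_left, inner_sub_right,
      inner_smul_left, inner_smul_right, hq, hsym, conj_trivial]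
    ring
  have e2 : quadBarrier 0 q (A + (-(6 * κ)) • ContinuousLinearMap.id ℝ (E n))
      (b - ε * ‖q‖ + 4 * κ) x₀ t₀ (x₀ + ξ, t₀ - τ)
      = inner ℝ q ξ + 1 / 2 * inner ℝ (A ξ) ξ - 3 * κ * ‖ξ‖ ^ 2
        - (b - ε * ‖q‖ + 4 * κ) * τ := by
    simp only [quadBarrier, add_sub_cancel_left, add_apply, smul_apply,
      ContinuousLinearMap.id_apply, inner_add_left, inner_smul_left, real_inner_self_eq_norm_sq,
      conj_trivial]
    ring
  rw [e1, hz] at h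
  rw [e2]
  have h1 : ε * τ * inner ℝ (A ξ) v ≤ ε * τ * (‖A‖ * ‖ξ‖) := by
    gcongr; exact (le_abs_self _).trans hAξ
  have h2 : 1 / 2 * (ε * τ) ^ 2 * (-inner ℝ (A v) v) ≤ 1 / 2 * (ε * τ) ^ 2 * ‖A‖ := by
    gcongr; exact (neg_le_abs _).trans hAv
  have h3 : κ * ‖ξ - (ε * τ) • v‖ ^ 2 ≤ κ * (2 * ‖ξ‖ ^ 2 + 2 * (ε * τ) ^ 2) := by gcongr
  have h4 : τ * (ε * ‖A‖ * ‖ξ‖ + 1 / 2 * ε ^ 2 * τ * ‖A‖ + 2 * κ * ε ^ 2 * τ) ≤ τ * κ := by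
    gcongr
  have h5 : 0 < κ * τ := by positivity
  -- The Taylor error costs at most `2κ|ξ|² + κτ`, apart from terms gathered in `hsmall`, which cost
  -- at most another `κτ`. The corrections `-6κ` and `4κ` contribute `-3κ|ξ|² - 4κτ`, while `ε‖q‖`
  -- absorbs the first order effect of the moving translation.
  linarith

/-- The case of a point at exactly the critical distance from the classical flow. -/
theorem exists_ball_measure_eq_zero_of_nearest (hn : 1 ≤ n)
    (hflow : IsSpacetimeBrakkeFlow a lam μ ν) (hΓ : IsMeanCurvatureFlow T M Γ) (hTa : T ≤ a)
    {t₀ ε R : ℝ} (ht₀ : t₀ ∈ Ioc 0 T) (hε : 0 < ε) (hR : 0 < R) {x₀ y₀ : E n} (hy₀ : y₀ ∈ Γ t₀)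
    (heq : ‖x₀ - y₀‖ = R) (hmin : ∀ y ∈ Γ t₀, R ≤ ‖x₀ - y‖)
    (hfar : ∀ t ∈ Ico 0 t₀, ∀ x ∈ (μ t).support, ∀ y ∈ Γ t, R + ε * (t₀ - t) < ‖x - y‖) :
    ∃ r' > 0, ∀ t ∈ Icc 0 a, |t - t₀| < r' → μ t (Metric.ball x₀ r') = 0 := by
  have hne : x₀ ≠ y₀ := by
    rintro rfl; rw [sub_self, norm_zero] at heq; exact hR.ne heq
  obtain ⟨u, q, A, b, hjet, hqeq⟩ :=
    hΓ.exists_isLevelSetJet_of_nearest ht₀ hy₀ hne (by rwa [heq])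
  rw [heq] at hqeq
  have hq : 0 < ‖q‖ := norm_pos_iff.2 hjet.grad_ne_zero
  set v : E n := R⁻¹ • (x₀ - y₀) with hv
  have hv1 : ‖v‖ = 1 := by
    rw [hv, norm_smul, heq, Real.norm_eq_abs, abs_of_pos (by positivity), inv_mul_cancel₀ hR.ne']
  have hqv : q = -‖q‖ • v := by
    conv_lhs => rw [hqeq]
    rw [hv, smul_smul]; congr 1; ring
  have hqv' : inner ℝ q v = -‖q‖ := by
    conv_lhs => rw [hqv]
    rw [inner_smul_left, real_inner_self_eq_norm_sq, hv1]; simp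
  have hxy : x₀ = y₀ + R • v := by
    rw [hv, smul_smul, mul_inv_cancel₀ hR.ne', one_smul]; abel
  have hn0 : (0 : ℝ) < n := by exact_mod_cast hn
  -- Strictness of the translated barrier requires `6κ(n - 1) + 4κ < ε‖q‖`; this choice leaves a
  -- margin of `6κ`.
  set κ := ε * ‖q‖ / (6 * n + 4) with hκ
  have hκ0 : 0 < κ := by positivity
  have hκe : κ * (6 * n + 4) = ε * ‖q‖ := by rw [hκ]; field_simp
  have hev := (hjet.eventually_exists_mem (e := v) (by rw [hqv']; linarith) hR).and
    (hjet.expansion κ hκ0)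
  let G : E n × ℝ → E n × ℝ := fun p => (x₀ + p.1 - (R + ε * p.2) • v, t₀ - p.2)
  have hG : Continuous G := by fun_prop
  have hG0 : G (0, 0) = (y₀, t₀) := by simp [G, hxy]
  have hev2 : ∀ᶠ p : E n × ℝ in 𝓝 (0, 0),
      ε * ‖A‖ * ‖p.1‖ + 1 / 2 * ε ^ 2 * p.2 * ‖A‖ + 2 * κ * ε ^ 2 * p.2 < κ := by
    have : Continuous fun p : E n × ℝ =>
        ε * ‖A‖ * ‖p.1‖ + 1 / 2 * ε ^ 2 * p.2 * ‖A‖ + 2 * κ * ε ^ 2 * p.2 := by fun_prop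
    exact this.continuousAt.eventually_lt_const (by simpa using hκ0)
  obtain ⟨δ, hδ, hball⟩ := Metric.eventually_nhds_iff.1
    (((hG.tendsto' (0, 0) (y₀, t₀) hG0).eventually hev).and hev2)
  refine hflow.exists_ball_measure_eq_zero_of_barrier hn (q := q)
    (A := A + (-(6 * κ)) • ContinuousLinearMap.id ℝ (E n)) (b := b - ε * ‖q‖ + 4 * κ)
    ?_ hjet.grad_ne_zero ?_ ht₀.1 (ht₀.2.trans hTa) hκ0 (r := min δ t₀) (lt_min hδ ht₀.1) ?_
  · intro x y
    rw [add_apply, add_apply, inner_add_left, inner_add_right, hjet.symm, inner_smul_id_symm]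
  · have h1 : (A + (-(6 * κ)) • ContinuousLinearMap.id ℝ (E n)).toLinearMap
        = A.toLinearMap + (-(6 * κ)) • LinearMap.id := rfl
    rw [h1, map_add, map_smul, LinearMap.trace_id]
    simp only [finrank_euclideanSpace_fin, add_apply, smul_apply, ContinuousLinearMap.id_apply,
      inner_add_right, inner_smul_right, real_inner_self_eq_norm_sq, smul_eq_mul]
    have h2 := hjet.equation
    have h3 : 0 < κ * ‖q‖ ^ 2 := by positivity
    have h4 : κ * (6 * n + 4) * ‖q‖ ^ 2 = ε * ‖q‖ * ‖q‖ ^ 2 := by rw [hκe]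
    nlinarith
  · intro t ht htt x hx hxx
    have h1 := min_le_left δ t₀
    have h2 := min_le_right δ t₀
    have hτ : 0 < t₀ - t := by linarith [ht.2]
    have hnear : dist (x - x₀, t₀ - t) (0, 0) < δ := by
      rw [Prod.dist_eq, dist_zero_right, Real.dist_eq, sub_zero, abs_of_pos hτ]
      exact max_lt (by linarith) (by linarith)
    obtain ⟨⟨hcross, hexp⟩, hsmall⟩ := hball hnear
    simp only [G, add_sub_cancel, sub_sub_cancel] at hcross hexp
    -- If `u ≥ 0` at the shifted point, moving back towards `x` along `v` by some `s ≤ R` meets `Γ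
    -- t` at distance `R + ε(t₀ - t) - s` from `x`, contradicting `hfar`.
    have hneg : u (x - (R + ε * (t₀ - t)) • v, t) < 0 := by
      by_contra hcon
      obtain ⟨s, hs, hmem⟩ := hcross ⟨by linarith, ht.2.le.trans ht₀.2⟩ (not_lt.1 hcon)
      have h3 := hfar t ht x hx _ hmem
      rw [show x - (x - (R + ε * (t₀ - t)) • v + s • v) = (R + ε * (t₀ - t) - s) • v by
        rw [sub_smul]; abel, norm_smul, hv1, mul_one, Real.norm_eq_abs] at h3
      have h4 : 0 < ε * (t₀ - t) := mul_pos hε hτ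
      rw [abs_of_nonneg (by linarith [hs.2])] at h3
      linarith [hs.1]
    have h5 := (abs_le.1 hexp).1
    have h6 := quadBarrier_translate_le (ξ := x - x₀) (τ := t₀ - t) (b := b) (t₀ := t₀)
      hjet.symm hv1 hqv' hxy hε hκ0 hτ hsmall.le (by
        simp only [add_sub_cancel, sub_sub_cancel]
        rw [abs_sub_comm, abs_of_pos hτ] at h5
        linarith)
    simpa only [add_sub_cancel, sub_sub_cancel] using h6

/-- The flow cannot reach a tube around the classical flow whose radius shrinks at a positive
rate. -/
theorem exists_ball_measure_eq_zero_of_dist_le (hn : 1 ≤ n)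
    (hflow : IsSpacetimeBrakkeFlow a lam μ ν) (hΓ : IsMeanCurvatureFlow T M Γ) (hTa : T ≤ a)
    {t₀ ε R : ℝ} (ht₀ : t₀ ∈ Ioc 0 T) (hε : 0 < ε) (hR : 0 < R) {x₀ y₁ : E n} (hy₁ : y₁ ∈ Γ t₀)
    (hle : ‖x₀ - y₁‖ ≤ R)
    (hfar : ∀ t ∈ Ico 0 t₀, ∀ x ∈ (μ t).support, ∀ y ∈ Γ t, R + ε * (t₀ - t) < ‖x - y‖) :
    ∃ r' > 0, ∀ t ∈ Icc 0 a, |t - t₀| < r' → μ t (Metric.ball x₀ r') = 0 := by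
  have hslice : IsCompact (Γ t₀) := by
    have h1 : IsCompact ({p : E n × ℝ | p.2 ∈ Icc 0 T ∧ p.1 ∈ Γ p.2} ∩ {p | p.2 = t₀}) :=
      hΓ.isCompact_track.inter_right (isClosed_eq continuous_snd continuous_const)
    convert h1.image continuous_fst
    ext y
    constructor
    · intro hy
      exact ⟨(y, t₀), ⟨⟨⟨ht₀.1.le, ht₀.2⟩, hy⟩, rfl⟩, rfl⟩
    · rintro ⟨⟨y', t'⟩, ⟨⟨_, hy⟩, ht⟩, rfl⟩
      have : t' = t₀ := ht
      subst this
      exact hy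
  obtain ⟨y₀, hy₀, hmin⟩ := hslice.exists_isMinOn ⟨y₁, hy₁⟩
    (f := fun y => ‖x₀ - y‖) (by fun_prop)
  have hmin' : ∀ y ∈ Γ t₀, ‖x₀ - y₀‖ ≤ ‖x₀ - y‖ := fun y hy => hmin hy
  rcases ((hmin' y₁ hy₁).trans hle).lt_or_eq with hlt | heq
  · exact exists_ball_measure_eq_zero_of_dist_lt hn hflow hΓ ht₀ hε hy₀ hlt hfar
  · exact exists_ball_measure_eq_zero_of_nearest hn hflow hΓ hTa ht₀ hε hR hy₀ heq
      (fun y hy => heq ▸ hmin' y hy) hfar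

/-! ### The spacetime support -/

/-- The points of `ℝⁿ × [0, T]` near which the flow of measures does not vanish. -/
def spacetimeSupport (T : ℝ) (μ : ℝ → Measure (E n)) : Set (E n × ℝ) :=
  {p | p.2 ∈ Icc 0 T ∧ ∀ r > 0, ∃ t ∈ Icc 0 T, |t - p.2| < r ∧ μ t (Metric.ball p.1 r) ≠ 0}

/-- Closedness is the reason for using this set instead of the union of the supports of the `μ t`:
it makes a first contact time exist. -/
theorem isClosed_spacetimeSupport (T : ℝ) (μ : ℝ → Measure (E n)) :
    IsClosed (spacetimeSupport T μ) := by
  refine isClosed_of_closure_subset fun p hp => ?_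
  refine ⟨?_, fun r hr => ?_⟩
  · have h1 : IsClosed {p : E n × ℝ | p.2 ∈ Icc 0 T} := isClosed_Icc.preimage continuous_snd
    exact closure_minimal (fun p hp => hp.1) h1 hp
  · obtain ⟨p', hp', hd⟩ := Metric.mem_closure_iff.1 hp (r / 2) (by positivity)
    obtain ⟨t, ht, htt, hμ⟩ := hp'.2 (r / 2) (by positivity)
    rw [dist_comm, Prod.dist_eq, max_lt_iff] at hd
    refine ⟨t, ht, ?_, fun h0 => hμ (measure_mono_null ?_ h0)⟩
    · have h2 := hd.2
      rw [Real.dist_eq] at h2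
      have := abs_sub_le t p'.2 p.2
      linarith
    · exact Metric.ball_subset_ball' (by linarith [hd.1])

theorem mem_spacetimeSupport_of_mem_support {t : ℝ} (ht : t ∈ Icc 0 T) {x : E n}
    (hx : x ∈ (μ t).support) : (x, t) ∈ spacetimeSupport T μ := by
  refine ⟨ht, fun r hr => ⟨t, ht, by simpa using hr, ?_⟩⟩
  exact ((Measure.mem_support_iff_forall x).1 hx _ (Metric.ball_mem_nhds x hr)).ne'

theorem notMem_spacetimeSupport (hTa : T ≤ a) {x : E n} {t₀ : ℝ}
    (h : ∃ r > 0, ∀ t ∈ Icc 0 a, |t - t₀| < r → μ t (Metric.ball x r) = 0) :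
    (x, t₀) ∉ spacetimeSupport T μ := by
  rintro ⟨_, hmem⟩
  obtain ⟨r, hr, h⟩ := h
  obtain ⟨t, ht, htt, hμ⟩ := hmem r hr
  exact hμ (h t ⟨ht.1, ht.2.trans hTa⟩ htt)

/-- By avoidance of shrinking balls, mass cannot appear instantly away from the initial support, so
the larger set adds nothing at time `0`. -/
theorem mem_support_zero_of_mem_spacetimeSupport (hn : 1 ≤ n)
    (hflow : IsSpacetimeBrakkeFlow a lam μ ν) (hTa : T ≤ a) {x : E n}
    (hx : (x, 0) ∈ spacetimeSupport T μ) : x ∈ (μ 0).support := by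
  by_contra hcon
  obtain ⟨U, hU, hμU⟩ := Measure.notMem_support_iff_exists.1 hcon
  obtain ⟨r, hr, hball⟩ := Metric.mem_nhds_iff.1 hU
  refine notMem_spacetimeSupport hTa
    (hflow.exists_ball_measure_eq_zero hn hr le_rfl fun t ht htt => ?_) hx
  have : t = 0 := le_antisymm htt.2 ht.1
  subst this
  exact measure_mono_null hball hμU

end BrakkeFlow

/-! ### The first contact argument -/

theorem mainTheorem2 (n : ℕ) (hn : 1 ≤ n) (a T : ℝ) (hT : 0 < T) (hTa : T ≤ a)
    (V₀ : Measure (E n × Grass (n - 1) n)) (hV₀ : IsLocallyFiniteMeasure V₀)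
    (lam : Measure (E n × Grass (n - 1) n × ℝ)) (μ : ℝ → Measure (E n))
    (ν : Kernel (E n × ℝ) (Grass (n - 1) n))
    (hflow : IsSpacetimeBrakkeFlow a lam μ ν) (hstart : StartsFrom μ ν V₀)
    (M : Set (E n)) (hM : IsCompact M) (Γ : ℝ → Set (E n)) (hΓ : IsMeanCurvatureFlow T M Γ)
    (hdisj : Disjoint (μ 0).support (Γ 0)) :
    ∀ t ∈ Icc 0 T, Disjoint (μ t).support (Γ t) := by
  have hΓ0 : IsCompact (Γ 0) := hΓ.initial ▸ hM
  obtain ⟨ρ, hρ0, hρ⟩ := Metric.exists_pos_forall_lt_edist hΓ0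
    (Measure.isClosed_support (μ := μ 0)) hdisj.symm
  have hρpos : (0 : ℝ) < ρ := hρ0
  -- With this rate the tube radius `ρ - ε t` is at least `ρ / 2` on `[0, T]`.
  set ε : ℝ := ρ / (2 * T) with hε
  have hε0 : 0 < ε := by positivity
  have hεT : ε * T = ρ / 2 := by rw [hε]; field_simp
  -- the pairs of a point of the flow and a point of the tube around the classical flow
  set K : Set ((E n × ℝ) × E n) :=
    ({p : E n × ℝ | p.2 ∈ Icc 0 T ∧ p.1 ∈ Γ p.2} ×ˢ Metric.closedBall 0 ρ) ∩
      {r | (r.1.1 + r.2, r.1.2) ∈ spacetimeSupport T μ ∧ ‖r.2‖ ≤ ρ - ε * r.1.2} with hK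
  have hKc : IsCompact K := by
    refine (hΓ.isCompact_track.prod (isCompact_closedBall 0 _)).inter_right (IsClosed.inter ?_ ?_)
    · exact (isClosed_spacetimeSupport T μ).preimage (by fun_prop)
    · exact isClosed_le continuous_snd.norm
        (continuous_const.sub (continuous_const.mul (continuous_snd.comp continuous_fst)))
  have hmemK : ∀ t ∈ Icc 0 T, ∀ x ∈ (μ t).support, ∀ y ∈ Γ t, ‖x - y‖ ≤ ρ - ε * t →
      ((y, t), x - y) ∈ K := by
    intro t ht x hx y hy hxy
    refine ⟨⟨⟨ht, hy⟩, ?_⟩, ?_, hxy⟩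
    · rw [mem_closedBall_zero_iff]
      have : 0 ≤ ε * t := mul_nonneg hε0.le ht.1
      linarith
    · simpa using mem_spacetimeSupport_of_mem_support ht hx
  have hKe : K = ∅ := by
    by_contra hne
    -- A contact of minimal time. Before `t₀` the distance exceeds `ρ - ε t = (ρ - ε t₀) + ε (t₀ -
    -- t)`, which is `hfar` with `R = ρ - ε t₀`.
    obtain ⟨⟨⟨y₁, t₀⟩, ξ⟩, ⟨⟨⟨ht₀, hy₁⟩, -⟩, hsupp, hξ⟩, hmin⟩ :=
      hKc.exists_isMinOn (nonempty_iff_ne_empty.2 hne) (f := fun r => r.1.2) (by fun_prop)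
    simp only at ht₀ hy₁ hsupp hξ
    rcases ht₀.1.eq_or_lt with h0 | hpos
    · subst h0
      have h1 := hρ y₁ hy₁ _ (mem_support_zero_of_mem_spacetimeSupport hn hflow hTa hsupp)
      rw [edist_dist, dist_eq_norm, sub_add_cancel_left, norm_neg] at h1
      have h2 : ENNReal.ofReal ‖ξ‖ ≤ ρ := by
        rw [← ENNReal.ofReal_coe_nnreal]
        exact ENNReal.ofReal_le_ofReal (by linarith)
      exact absurd h1 (not_lt.2 h2)
    · have hεt : ε * t₀ ≤ ε * T := by gcongr; exact ht₀.2
      refine notMem_spacetimeSupport hTa (exists_ball_measure_eq_zero_of_dist_le hn hflow hΓ hTa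
        ⟨hpos, ht₀.2⟩ hε0 (R := ρ - ε * t₀) (by linarith) hy₁
        (by rwa [add_sub_cancel_left]) ?_) hsupp
      intro t ht x hx y hy
      by_contra hcon
      have h1 := hmin (hmemK t ⟨ht.1, ht.2.le.trans ht₀.2⟩ x hx y hy (by linarith [not_lt.1 hcon]))
      exact absurd ht.2 (not_lt.2 h1)
  intro t ht
  rw [Set.disjoint_left]
  intro x hx hxΓ
  have hεt : ε * t ≤ ε * T := by gcongr; exact ht.2
  -- A common point would be a contact with displacement `0`, which lies in every tube.
  have h1 := hmemK t ht x hx x hxΓ (by rw [sub_self, norm_zero]; linarith)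
  rw [hKe] at h1
  exact h1
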